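/- Let $c>0$ and let $$T=(1-x^2)\frac{d^2}{dx^2}-2x\frac{d}{dx}-c^2x^2$$ act on the complex-valued functions that are smooth on $[-1,1]$ (up to the endpoints). Define polynomials $U_k$, $k\ge 0$, by $U_0=1$ and $$U_{k+1}(X)=\frac{X+c^2+k(k+1)}{2(k+1)}\,U_k(X)-\frac{c^2k}{k+1}\,U_{k-1}(X)+\frac{c^2k(k-1)}{2(k+1)}\,U_{k-2}(X),\qquad k\ge 0,$$ where the terms with negative index are absent. For $\xi\in[0,2)$ let $U(\xi;T)$ be the closure in $L^2[-1,1]$ of the operator $$f\longmapsto\sum_{k=0}^{\infty}\frac{\xi^k}{k!}\,U_k(T)f ,$$ defined on those smooth $f$ for which the series converges in $L^2[-1,1]$. Let $\mathcal Q_c$ be the operator on $L^2[-1,1]$ given by $$\mathcal Q_c[\phi](x)=\int_{-1}^{1}\frac{\sin(c(x-t))}{\pi(x-t)}\,\phi(t)\,dt .$$ Then for every $\xi\in[0,2)$ the closure $U(\xi;T)$ is (the graph of) a bounded operator defined on all of $L^2[-1,1]$, and $$\mathcal Q_c=\int_0^2\frac{\sin(c\xi)}{\pi\xi}\,U(\xi;T)\,d\xi$$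 as operators on $L^2[-1,1]$; that is, for every $\phi\in L^2[-1,1]$ the function $\xi\mapsto\frac{\sin(c\xi)}{\pi\xi}U(\xi;T)\phi$ is Bochner integrable on $(0,2)$ and its integral is $\mathcal Q_c\phi$. -/

import Mathlib

open MeasureTheory Filter Topology

/-- Lebesgue measure on the interval `[-1, 1]`. -/
noncomputable abbrev muI : Measure ℝ := volume.restrict (Set.Icc (-1 : ℝ) 1)

/-- The complex Hilbert space `L²[-1, 1]`. -/
noncomputable abbrev L2I : Type := Lp ℂ 2 muI

/-- The space of smooth functions; only their restrictions to `[-1, 1]` (which are exactly the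
functions smooth up to the endpoints) will matter. -/
def SmoothFun : Submodule ℂ (ℝ → ℂ) where
  carrier := {f | ContDiff ℝ (⊤ : ℕ∞) f}
  add_mem' {f g} hf hg := by
    have hf : ContDiff ℝ (⊤ : ℕ∞) f := hf
    have hg : ContDiff ℝ (⊤ : ℕ∞) g := hg
    exact hf.add hg
  zero_mem' := by
    have h : ContDiff ℝ (⊤ : ℕ∞) (fun _ : ℝ => (0 : ℂ)) := contDiff_const
    exact h
  smul_mem' a f hf := by
    have hf : ContDiff ℝ (⊤ : ℕ∞) f := hf
    exact hf.const_smul a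

/-- The differential expression `T = (1 - x²) d²/dx² - 2 x d/dx - c² x²`. -/
noncomputable def heunExpr (c : ℝ) (f : ℝ → ℂ) (x : ℝ) : ℂ :=
  (1 - (x : ℂ) ^ 2) * deriv (deriv f) x - 2 * (x : ℂ) * deriv f x
    - (c : ℂ) ^ 2 * (x : ℂ) ^ 2 * f x

theorem deriv_smooth {f : ℝ → ℂ} (hf : ContDiff ℝ (⊤ : ℕ∞) f) :
    ContDiff ℝ (⊤ : ℕ∞) (deriv f) :=
  (contDiff_infty_iff_deriv.1 hf).2

theorem heunExpr_smooth (c : ℝ) {f : ℝ → ℂ} (hf : ContDiff ℝ (⊤ : ℕ∞) f) :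
    ContDiff ℝ (⊤ : ℕ∞) (heunExpr c f) := by
  have h1 := deriv_smooth hf
  have h2 := deriv_smooth h1
  have hx : ContDiff ℝ (⊤ : ℕ∞) (fun x : ℝ => (x : ℂ)) := Complex.ofRealCLM.contDiff
  exact (((contDiff_const.sub (hx.pow 2)).mul h2).sub ((contDiff_const.mul hx).mul h1)).sub
    ((contDiff_const.mul (hx.pow 2)).mul hf)

/-- The Heun operator `T` as an endomorphism of the space of smooth functions. -/
noncomputable def heunT (c : ℝ) : Module.End ℂ SmoothFun where
  toFun f := ⟨heunExpr c f, heunExpr_smooth c f.2⟩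
  map_add' f g := by
    have hf : Differentiable ℝ (f : ℝ → ℂ) :=
      ContDiff.differentiable (show ContDiff ℝ (⊤ : ℕ∞) (f : ℝ → ℂ) from f.2) (by simp)
    have hg : Differentiable ℝ (g : ℝ → ℂ) :=
      ContDiff.differentiable (show ContDiff ℝ (⊤ : ℕ∞) (g : ℝ → ℂ) from g.2) (by simp)
    have hf' : Differentiable ℝ (deriv (f : ℝ → ℂ)) :=
      (deriv_smooth f.2).differentiable (by simp)
    have hg' : Differentiable ℝ (deriv (g : ℝ → ℂ)) :=
      (deriv_smooth g.2).differentiable (by simp)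
    have h1 : deriv ((f : ℝ → ℂ) + (g : ℝ → ℂ)) = deriv (f : ℝ → ℂ) + deriv (g : ℝ → ℂ) := by
      funext x
      exact deriv_add (hf x) (hg x)
    have h2 : deriv (deriv (f : ℝ → ℂ) + deriv (g : ℝ → ℂ))
        = deriv (deriv (f : ℝ → ℂ)) + deriv (deriv (g : ℝ → ℂ)) := by
      funext x
      exact deriv_add (hf' x) (hg' x)
    apply Subtype.ext
    funext x
    simp only [Submodule.coe_add, Pi.add_apply, heunExpr, h1, h2]
    ring
  map_smul' a f := by
    have h1 : deriv (a • (f : ℝ → ℂ)) = a • deriv (f : ℝ → ℂ) := by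
      funext x
      exact deriv_const_smul_field a _
    have h2 : deriv (a • deriv (f : ℝ → ℂ)) = a • deriv (deriv (f : ℝ → ℂ)) := by
      funext x
      exact deriv_const_smul_field a _
    apply Subtype.ext
    funext x
    simp only [Submodule.coe_smul, Pi.smul_apply, heunExpr, h1, h2, smul_eq_mul,
      RingHom.id_apply]
    ring

open Polynomial in
/-- The polynomials `U_k`: `U_0 = 1` and
`U_{k+1} = (X + c² + k(k+1)) / (2(k+1)) U_k - c² k / (k+1) U_{k-1} + c² k(k-1) / (2(k+1)) U_{k-2}`.
The coefficients of `U_{k-1}` and `U_{k-2}` vanish whenever the index would be negative. -/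
noncomputable def polyU (c : ℝ) : ℕ → ℂ[X]
  | 0 => 1
  | k + 1 =>
      C (1 / (2 * ((k : ℂ) + 1))) * (X + C ((c : ℂ) ^ 2 + (k : ℂ) * ((k : ℂ) + 1))) * polyU c k
        - C ((c : ℂ) ^ 2 * (k : ℂ) / ((k : ℂ) + 1)) * polyU c (k - 1)
        + C ((c : ℂ) ^ 2 * (k : ℂ) * ((k : ℂ) - 1) / (2 * ((k : ℂ) + 1))) * polyU c (k - 2)
  termination_by k => k
  decreasing_by all_goals omega

theorem smooth_memLp (f : SmoothFun) : MemLp (f : ℝ → ℂ) 2 muI := by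
  have hf : Continuous (f : ℝ → ℂ) :=
    ContDiff.continuous (show ContDiff ℝ (⊤ : ℕ∞) (f : ℝ → ℂ) from f.2)
  obtain ⟨C, hC⟩ := isCompact_Icc.exists_bound_of_continuousOn
    (hf.continuousOn (s := Set.Icc (-1 : ℝ) 1))
  exact MemLp.of_bound hf.aestronglyMeasurable C
    (ae_restrict_of_forall_mem measurableSet_Icc hC)

/-- The class in `L²[-1, 1]` of a smooth function. -/
noncomputable def smoothToL2 : SmoothFun →ₗ[ℂ] L2I where
  toFun f := (smooth_memLp f).toLp (f : ℝ → ℂ)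
  map_add' _ _ := rfl
  map_smul' _ _ := rfl

/-- The partial sums `∑_{k < n} ξ^k / k! U_k(T) f`, as elements of `L²[-1, 1]`. -/
noncomputable def partialU (c ξ : ℝ) (n : ℕ) : SmoothFun →ₗ[ℂ] L2I :=
  ∑ k ∈ Finset.range n, ((ξ : ℂ) ^ k / (k.factorial : ℂ)) •
    (smoothToL2 ∘ₗ Polynomial.aeval (heunT c) (polyU c k))

/-- The graph of the operator `f ↦ ∑_{k ≥ 0} ξ^k / k! U_k(T) f`, defined on those smooth `f` for
which the series converges in `L²[-1, 1]`. -/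
noncomputable def seriesGraph (c ξ : ℝ) : Submodule ℂ (L2I × L2I) where
  carrier := {p | ∃ f : SmoothFun, smoothToL2 f = p.1 ∧
    Tendsto (fun n => partialU c ξ n f) atTop (𝓝 p.2)}
  add_mem' := by
    rintro p q ⟨f, hf, hf'⟩ ⟨g, hg, hg'⟩
    refine ⟨f + g, by simp [hf, hg], ?_⟩
    simpa using hf'.add hg'
  zero_mem' := ⟨0, by simp, by simp⟩
  smul_mem' := by
    rintro a p ⟨f, hf, hf'⟩
    refine ⟨a • f, by simp [hf], ?_⟩
    simpa using hf'.const_smul a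

/-- The graph of `U(ξ; T)`: the closure in `L²[-1, 1]` of the operator defined by the series. -/
noncomputable def graphU (c ξ : ℝ) : Submodule ℂ (L2I × L2I) := (seriesGraph c ξ).topologicalClosure

/-- `Q_c[φ](x) = ∫_{-1}^{1} sin(c(x-t)) / (π(x-t)) φ(t) dt`. -/
noncomputable def sincTransform (c : ℝ) (φ : ℝ → ℂ) (x : ℝ) : ℂ :=
  ∫ t in (-1 : ℝ)..1, ((Real.sin (c * (x - t)) / (Real.pi * (x - t)) : ℝ) : ℂ) * φ t

theorem sincKernel_bound (c u : ℝ) :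
    ‖((Real.sin (c * u) / (Real.pi * u) : ℝ) : ℂ)‖ ≤ |c| / Real.pi := by
  rw [Complex.norm_real, Real.norm_eq_abs, abs_div, abs_mul, abs_of_pos Real.pi_pos]
  rcases eq_or_ne u 0 with rfl | hu
  · simp only [abs_zero, mul_zero, div_zero]
    positivity
  · rw [div_le_div_iff₀ (by positivity) Real.pi_pos]
    have h : |Real.sin (c * u)| ≤ |c| * |u| := by
      rw [← abs_mul]
      exact Real.abs_sin_le_abs
    nlinarith [Real.pi_pos]

theorem sincTransform_memLp (c : ℝ) (φ : L2I) : MemLp (sincTransform c φ) 2 muI := by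
  have hm : StronglyMeasurable (sincTransform c φ) := by
    have hφ : StronglyMeasurable (φ : ℝ → ℂ) := Lp.stronglyMeasurable φ
    have h : StronglyMeasurable (Function.uncurry fun x t : ℝ =>
        ((Real.sin (c * (x - t)) / (Real.pi * (x - t)) : ℝ) : ℂ) * (φ : ℝ → ℂ) t) := by
      simp only [Function.uncurry_def]
      refine StronglyMeasurable.mul (Measurable.stronglyMeasurable (by fun_prop)) ?_
      exact hφ.comp_measurable measurable_snd
    have h' := h.integral_prod_right (ν := volume.restrict (Set.Ioc (-1 : ℝ) 1))
    have he : sincTransform c φ = fun x => ∫ t, ((Real.sin (c * (x - t)) /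
        (Real.pi * (x - t)) : ℝ) : ℂ) * (φ : ℝ → ℂ) t
          ∂(volume.restrict (Set.Ioc (-1 : ℝ) 1)) := by
      funext x
      rw [sincTransform, intervalIntegral.integral_of_le (by norm_num)]
    rw [he]
    exact h'
  have hi : Integrable (φ : ℝ → ℂ) (volume.restrict (Set.Ioc (-1 : ℝ) 1)) :=
    ((Lp.memLp φ).integrable (by norm_num)).mono_measure
      (Measure.restrict_mono Set.Ioc_subset_Icc_self le_rfl)
  refine MemLp.of_bound hm.aestronglyMeasurable
    (∫ t in Set.Ioc (-1 : ℝ) 1, |c| / Real.pi * ‖(φ : ℝ → ℂ) t‖) (ae_of_all _ fun x => ?_)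
  rw [sincTransform, intervalIntegral.integral_of_le (by norm_num)]
  refine norm_integral_le_of_norm_le (hi.norm.const_mul _) (ae_of_all _ fun t => ?_)
  rw [norm_mul]
  exact mul_le_mul_of_nonneg_right (sincKernel_bound c (x - t)) (norm_nonneg _)

/-- The time and band limiting operator `Q_c` on `L²[-1, 1]`. -/
noncomputable def opQ (c : ℝ) (φ : L2I) : L2I := (sincTransform_memLp c φ).toLp _

/-! ### Integration by parts for the Heun operator -/

/-! Let `Ψ` be an entire solution of `T Ψ = χ Ψ`. The leading coefficient `1 - z²` vanishes at `z =
1`, so differentiating the equation there gives a recurrence for the derivatives, solved by `Ψ⁽ᵏ⁾(1)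
= (-1)ᵏ U_k(χ) Ψ(1)`. Taylor's formula at `1` then sums the series: `∑ ξᵏ/k! U_k(χ) = Ψ(1-ξ)/Ψ(1)`
(`IsHeunEigen.hasSum`). Hence `U(ξ;T)` should be the diagonal operator with these multipliers in a
basis of such eigenfunctions.

The basis comes from the integral operator `H` with kernel `cos(cxt) + sin(cxt)`. It is compact,
symmetric and injective, it commutes with `T`, and `H² = (2π/c) Q_c`. Its eigenfunctions for nonzero
eigenvalues are entire, and diagonalising `T` on its finite-dimensional eigenspaces gives joint
eigenfunctions (`exists_prolate_hilbertBasis`). An energy estimate bounds `|Ψ|` on `[-1, 1]` by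
`heunBound c * |Ψ(1)|`, uniformly in `χ`, so the diagonal operators are bounded; `graph_eq_graphU`
identifies their graphs with the closures.

For the integral formula, coefficients along each `Ψ` are compared. Evaluating `H²Ψ = h²Ψ` at `x =
1` and substituting `ξ = 1 - t` shows that `∫ sin(cξ)/(πξ) Ψ(1-ξ)/Ψ(1) dξ` is the eigenvalue of
`Q_c` (`IsProlate.integral_sinc`). -/

theorem smoothFun_contDiff (f : SmoothFun) : ContDiff ℝ (⊤ : ℕ∞) (f : ℝ → ℂ) := f.2

theorem integral_muI (f : ℝ → ℂ) : ∫ x, f x ∂muI = ∫ x in (-1 : ℝ)..1, f x := by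
  rw [intervalIntegral.integral_of_le (by norm_num), integral_Icc_eq_integral_Ioc]

/-- The second-order part of `T` is the derivative of `(1 - x²) f'`, which vanishes at both
endpoints. No boundary condition on `f` or `g` is therefore needed, and symmetry and negativity of
`T` follow. -/
theorem integral_mul_heunExpr (c : ℝ) {f g : ℝ → ℂ} (hf : ContDiff ℝ (⊤ : ℕ∞) f)
    (hg : ContDiff ℝ (⊤ : ℕ∞) g) :
    ∫ x, g x * heunExpr c f x ∂muI =
      -∫ x, ((1 - (x : ℂ) ^ 2) * (deriv g x * deriv f x) + (c : ℂ) ^ 2 * (x : ℂ) ^ 2 * (g x * f x))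
        ∂muI := by
  have hf1 := deriv_smooth hf
  have hf2 := deriv_smooth hf1
  have hg1 := deriv_smooth hg
  have hdg : ∀ x, HasDerivAt g (deriv g x) x := fun x =>
    ((hg.differentiable (by simp)) x).hasDerivAt
  have hdf : ∀ x, HasDerivAt (deriv f) (deriv (deriv f) x) x := fun x =>
    ((hf1.differentiable (by simp)) x).hasDerivAt
  have hx : ∀ x : ℝ, HasDerivAt (fun y : ℝ => (y : ℂ)) 1 x := fun x =>
    Complex.ofRealCLM.hasDerivAt
  have hp : ∀ x : ℝ, HasDerivAt (fun y : ℝ => (1 - (y : ℂ) ^ 2) * deriv f y)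
      ((1 - (x : ℂ) ^ 2) * deriv (deriv f) x - 2 * (x : ℂ) * deriv f x) x := fun x => by
    have h := (((hx x).pow 2).const_sub 1).mul (hdf x)
    refine h.congr_deriv ?_
    simp only [Nat.cast_ofNat, Nat.add_one_sub_one, pow_one, mul_one, Pi.pow_apply]
    ring
  have c0 := hf.continuous
  have c1 := hf1.continuous
  have c2 := hf2.continuous
  have d0 := hg.continuous
  have d1 := hg1.continuous
  have key := intervalIntegral.integral_mul_deriv_eq_deriv_mul (a := -1) (b := 1)
    (fun x _ => hdg x) (fun x _ => hp x) (d1.intervalIntegrable _ _)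
    (Continuous.intervalIntegrable (by fun_prop) _ _)
  rw [integral_muI, integral_muI]
  have e1 : ∀ x : ℝ, g x * heunExpr c f x =
      g x * ((1 - (x : ℂ) ^ 2) * deriv (deriv f) x - 2 * (x : ℂ) * deriv f x)
        - (c : ℂ) ^ 2 * (x : ℂ) ^ 2 * (g x * f x) := fun x => by
    rw [heunExpr]; ring
  have e2 : ∀ x : ℝ, (1 - (x : ℂ) ^ 2) * (deriv g x * deriv f x) =
      deriv g x * ((1 - (x : ℂ) ^ 2) * deriv f x) := fun x => by ring
  simp_rw [e1, e2]
  rw [intervalIntegral.integral_sub (Continuous.intervalIntegrable (by fun_prop) _ _)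
    (Continuous.intervalIntegrable (by fun_prop) _ _), key,
    intervalIntegral.integral_add (Continuous.intervalIntegrable (by fun_prop) _ _)
    (Continuous.intervalIntegrable (by fun_prop) _ _)]
  push_cast
  ring

theorem integral_mul_heunExpr_comm (c : ℝ) {f g : ℝ → ℂ} (hf : ContDiff ℝ (⊤ : ℕ∞) f)
    (hg : ContDiff ℝ (⊤ : ℕ∞) g) :
    ∫ x, g x * heunExpr c f x ∂muI = ∫ x, heunExpr c g x * f x ∂muI := by
  simp_rw [mul_comm (heunExpr c g _)]
  rw [integral_mul_heunExpr c hf hg, integral_mul_heunExpr c hg hf]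
  simp_rw [mul_comm (deriv f _), mul_comm (f _)]

theorem deriv_conj {f : ℝ → ℂ} (hf : ContDiff ℝ (⊤ : ℕ∞) f) :
    deriv (fun x => star (f x)) = fun x => star (deriv f x) := by
  funext x
  exact ((hf.differentiable (by simp)) x).hasDerivAt.star.deriv

theorem contDiff_conj {f : ℝ → ℂ} (hf : ContDiff ℝ (⊤ : ℕ∞) f) :
    ContDiff ℝ (⊤ : ℕ∞) (fun x => star (f x)) :=
  (Complex.conjCLE : ℂ ≃L[ℝ] ℂ).contDiff.comp hf

theorem heunExpr_conj (c : ℝ) {f : ℝ → ℂ} (hf : ContDiff ℝ (⊤ : ℕ∞) f) (x : ℝ) :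
    heunExpr c (fun x => star (f x)) x = star (heunExpr c f x) := by
  rw [heunExpr, deriv_conj hf, deriv_conj (deriv_smooth hf), heunExpr]
  simp

theorem coeFn_smoothToL2 (f : SmoothFun) : smoothToL2 f =ᵐ[muI] (f : ℝ → ℂ) :=
  (smooth_memLp f).coeFn_toLp

open scoped InnerProductSpace in
theorem inner_smoothToL2_left (f : SmoothFun) (φ : L2I) :
    ⟪smoothToL2 f, φ⟫_ℂ = ∫ x, star ((f : ℝ → ℂ) x) * φ x ∂muI := by
  rw [L2.inner_def]
  refine integral_congr_ae ?_
  filter_upwards [coeFn_smoothToL2 f] with x hx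
  rw [hx, RCLike.inner_apply, mul_comm]
  rfl

open scoped InnerProductSpace in
theorem inner_smoothToL2 (f g : SmoothFun) :
    ⟪smoothToL2 f, smoothToL2 g⟫_ℂ = ∫ x, star ((f : ℝ → ℂ) x) * (g : ℝ → ℂ) x ∂muI := by
  rw [inner_smoothToL2_left]
  refine integral_congr_ae ?_
  filter_upwards [coeFn_smoothToL2 g] with x hx
  rw [hx]

open scoped InnerProductSpace in
theorem inner_heunT (c : ℝ) (f g : SmoothFun) :
    ⟪smoothToL2 (heunT c f), smoothToL2 g⟫_ℂ = ⟪smoothToL2 f, smoothToL2 (heunT c g)⟫_ℂ := by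
  rw [inner_smoothToL2, inner_smoothToL2]
  have h := integral_mul_heunExpr_comm c (smoothFun_contDiff g) (contDiff_conj (smoothFun_contDiff f))
  simp_rw [heunExpr_conj c (smoothFun_contDiff f)] at h
  exact h.symm

open scoped InnerProductSpace in
theorem re_inner_heunT_nonpos (c : ℝ) (f : SmoothFun) :
    (⟪smoothToL2 f, smoothToL2 (heunT c f)⟫_ℂ).re ≤ 0 := by
  rw [inner_smoothToL2]
  have h := integral_mul_heunExpr c (smoothFun_contDiff f) (contDiff_conj (smoothFun_contDiff f))
  change (∫ x, star ((f : ℝ → ℂ) x) * heunExpr c f x ∂muI).re ≤ 0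
  rw [h, deriv_conj (smoothFun_contDiff f)]
  have e : ∀ x : ℝ, (1 - (x : ℂ) ^ 2) * (star (deriv (f : ℝ → ℂ) x) * deriv (f : ℝ → ℂ) x) +
      (c : ℂ) ^ 2 * (x : ℂ) ^ 2 * (star ((f : ℝ → ℂ) x) * (f : ℝ → ℂ) x) =
      (((1 - x ^ 2) * ‖deriv (f : ℝ → ℂ) x‖ ^ 2 + c ^ 2 * x ^ 2 * ‖(f : ℝ → ℂ) x‖ ^ 2 : ℝ) : ℂ) := by
    intro x
    have hs : ∀ z : ℂ, star z * z = (‖z‖ : ℂ) ^ 2 := Complex.conj_mul'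
    rw [hs, hs]
    push_cast
    ring
  simp_rw [e]
  rw [integral_complex_ofReal, Complex.neg_re, Complex.ofReal_re, neg_nonpos]
  refine setIntegral_nonneg measurableSet_Icc fun x hx => ?_
  have : 0 ≤ 1 - x ^ 2 := by nlinarith [hx.1, hx.2]
  positivity

theorem eqOn_of_smoothToL2_eq {f g : SmoothFun} (h : smoothToL2 f = smoothToL2 g) :
    Set.EqOn (f : ℝ → ℂ) g (Set.Icc (-1) 1) := by
  have h1 : (f : ℝ → ℂ) =ᵐ[muI] g := by
    filter_upwards [coeFn_smoothToL2 f, coeFn_smoothToL2 g] with x h1 h2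
    rw [← h1, ← h2, h]
  exact Measure.eqOn_Icc_of_ae_eq volume (by norm_num) h1 (smoothFun_contDiff f).continuous.continuousOn
    (smoothFun_contDiff g).continuous.continuousOn

/-! ### Entire eigenfunctions of the Heun operator -/

/-- `Ψ` is an entire solution of `T Ψ = χ Ψ`. -/
def IsHeunEigen (c χ : ℝ) (Ψ : ℂ → ℂ) : Prop :=
  Differentiable ℂ Ψ ∧ ∀ z : ℂ, (1 - z ^ 2) * deriv (deriv Ψ) z - 2 * z * deriv Ψ z
    - (c : ℂ) ^ 2 * z ^ 2 * Ψ z = χ * Ψ z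

theorem hasDerivAt_iteratedDeriv {Ψ : ℂ → ℂ} (h : Differentiable ℂ Ψ) (n : ℕ) (z : ℂ) :
    HasDerivAt (iteratedDeriv n Ψ) (iteratedDeriv (n + 1) Ψ z) z := by
  rw [iteratedDeriv_succ]
  have hd : ContDiff ℂ (⊤ : ℕ∞) Ψ := h.contDiff
  exact (hd.differentiable_iteratedDeriv n (mod_cast WithTop.coe_lt_top n) z).hasDerivAt

/-- The equation `T Ψ = χ Ψ` differentiated `k` times. -/
theorem IsHeunEigen.iteratedDeriv_eq {c χ : ℝ} {Ψ : ℂ → ℂ} (h : IsHeunEigen c χ Ψ) (k : ℕ) :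
    ∀ z : ℂ, (1 - z ^ 2) * iteratedDeriv (k + 2) Ψ z
      - 2 * (k + 1) * (z * iteratedDeriv (k + 1) Ψ z)
      - (k * (k + 1) + χ + (c : ℂ) ^ 2 * z ^ 2) * iteratedDeriv k Ψ z
      - 2 * (c : ℂ) ^ 2 * (z * (k * iteratedDeriv (k - 1) Ψ z))
      - (c : ℂ) ^ 2 * (k * (k - 1) * iteratedDeriv (k - 2) Ψ z) = 0 := by
  induction k with
  | zero =>
    intro z
    have h2 := h.2 z
    rw [show iteratedDeriv (0 + 2) Ψ = deriv (deriv Ψ) by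
      rw [iteratedDeriv_succ, iteratedDeriv_one], zero_add, iteratedDeriv_one,
      iteratedDeriv_zero]
    push_cast
    linear_combination h2
  | succ k ih =>
    intro z
    have d := hasDerivAt_iteratedDeriv h.1
    -- The factors `k` and `k(k-1)` stay attached to the lower derivatives: they vanish exactly
    -- where the subtraction in the index is truncated.
    have d1 : HasDerivAt (fun z => (k : ℂ) * iteratedDeriv (k - 1) Ψ z)
        (k * iteratedDeriv k Ψ z) z := by
      rcases k with _ | k
      · simpa using hasDerivAt_const z (0 : ℂ)
      · exact (d k z).const_mul _
    have d2 : HasDerivAt (fun z => (k : ℂ) * (k - 1) * iteratedDeriv (k - 2) Ψ z)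
        (k * (k - 1) * iteratedDeriv (k - 1) Ψ z) z := by
      rcases k with _ | _ | k
      · simpa using hasDerivAt_const z (0 : ℂ)
      · simpa using hasDerivAt_const z (0 : ℂ)
      · exact (d k z).const_mul _
    have hid := hasDerivAt_id' z
    have hsq : HasDerivAt (fun z : ℂ => z ^ 2) (2 * z) z := by simpa using hasDerivAt_pow 2 z
    have H := (((((hsq.const_sub 1).mul (d (k + 2) z)).sub
      ((hid.mul (d (k + 1) z)).const_mul (2 * ((k : ℂ) + 1)))).sub
      (((hsq.const_mul ((c : ℂ) ^ 2)).const_add ((k : ℂ) * (k + 1) + χ)).mul (d k z))).sub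
      ((hid.mul d1).const_mul (2 * (c : ℂ) ^ 2))).sub (d2.const_mul ((c : ℂ) ^ 2))
    have H0 := H.unique ((hasDerivAt_const z (0 : ℂ)).congr_of_eventuallyEq
      (Eventually.of_forall fun w => ih w))
    simp only [Nat.add_sub_cancel, show k + 1 - 2 = k - 1 by omega]
    push_cast
    linear_combination H0

/-- At `z = 1` the term of order `k + 2` drops out, so the derivative of order `k + 1` is determined
by lower ones, by the recurrence of `polyU` up to the sign `(-1)ᵏ`. -/
theorem IsHeunEigen.iteratedDeriv_one_eq {c χ : ℝ} {Ψ : ℂ → ℂ} (h : IsHeunEigen c χ Ψ) (k : ℕ) :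
    iteratedDeriv k Ψ 1 = (-1) ^ k * (polyU c k).eval (χ : ℂ) * Ψ 1 := by
  induction k using Nat.strong_induction_on with
  | _ k ih =>
    rcases k with _ | k
    · simp [polyU]
    · have e := h.iteratedDeriv_eq k 1
      have hk : (k : ℂ) + 1 ≠ 0 := Nat.cast_add_one_ne_zero k
      have e0 := ih k (by omega)
      have e1 : (k : ℂ) * iteratedDeriv (k - 1) Ψ 1 =
          k * (-((-1) ^ k * (polyU c (k - 1)).eval (χ : ℂ) * Ψ 1)) := by
        rcases k with _ | k
        · simp
        · rw [ih (k + 1 - 1) (by omega), pow_succ]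
          simp only [Nat.add_sub_cancel]
          ring
      have e2 : (k : ℂ) * (k - 1) * iteratedDeriv (k - 2) Ψ 1 =
          k * (k - 1) * ((-1) ^ k * (polyU c (k - 2)).eval (χ : ℂ) * Ψ 1) := by
        rcases k with _ | _ | k
        · simp
        · simp
        · rw [ih (k + 1 + 1 - 2) (by omega), pow_succ, pow_succ]
          simp only [show k + 1 + 1 - 2 = k by omega]
          ring
      rw [e0, e1, e2] at e
      rw [polyU]
      simp only [Polynomial.eval_add, Polynomial.eval_sub, Polynomial.eval_mul, Polynomial.eval_C,
        Polynomial.eval_X]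
      rw [pow_succ]
      field_simp
      linear_combination (-1 : ℂ) * e

/-- The series `∑ ξ^k / k! U_k(χ)` sums to `Ψ (1 - ξ) / Ψ 1`. -/
theorem IsHeunEigen.hasSum {c χ : ℝ} {Ψ : ℂ → ℂ} (h : IsHeunEigen c χ Ψ) (ξ : ℂ) :
    HasSum (fun k : ℕ => ξ ^ k / (k.factorial : ℂ) * (polyU c k).eval (χ : ℂ) * Ψ 1)
      (Ψ (1 - ξ)) := by
  refine (Complex.hasSum_taylorSeries_of_entire h.1 1 (1 - ξ)).congr_fun fun k => ?_
  rw [h.iteratedDeriv_one_eq, smul_eq_mul, smul_eq_mul, show (1 - ξ - 1 : ℂ) = (-1) * ξ by ring,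
    mul_pow, div_eq_mul_inv]
  have : ((-1 : ℂ) ^ k) * (-1) ^ k = 1 := by rw [← mul_pow]; simp
  linear_combination (-(k.factorial : ℂ)⁻¹ * ξ ^ k * (polyU c k).eval (χ : ℂ) * Ψ 1) * this

/-- All Taylor coefficients at the singular point `1` are multiples of `Ψ 1`. Entire solutions for a
given `χ` thus form a space of dimension at most one. -/
theorem IsHeunEigen.eq_zero {c χ : ℝ} {Ψ : ℂ → ℂ} (h : IsHeunEigen c χ Ψ) (h1 : Ψ 1 = 0) (z : ℂ) :
    Ψ z = 0 := by
  have := h.hasSum (1 - z)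
  simp only [h1, mul_zero, sub_sub_cancel] at this
  exact this.unique hasSum_zero

theorem IsHeunEigen.add {c χ : ℝ} {Ψ Φ : ℂ → ℂ} (h : IsHeunEigen c χ Ψ) (h' : IsHeunEigen c χ Φ) :
    IsHeunEigen c χ (fun z => Ψ z + Φ z) := by
  have d : deriv (fun z => Ψ z + Φ z) = fun z => deriv Ψ z + deriv Φ z := by
    funext z
    exact deriv_add (h.1 z) (h'.1 z)
  have d' : deriv (fun z => deriv Ψ z + deriv Φ z) =
      fun z => deriv (deriv Ψ) z + deriv (deriv Φ) z := by
    funext z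
    exact deriv_add (h.1.deriv z) (h'.1.deriv z)
  refine ⟨h.1.add h'.1, fun z => ?_⟩
  rw [d, d']
  linear_combination h.2 z + h'.2 z

theorem IsHeunEigen.const_mul {c χ : ℝ} {Ψ : ℂ → ℂ} (h : IsHeunEigen c χ Ψ) (a : ℂ) :
    IsHeunEigen c χ (fun z => a * Ψ z) := by
  have d : deriv (fun z => a * Ψ z) = fun z => a * deriv Ψ z := by
    funext z
    exact deriv_const_mul_field a
  have d' : deriv (fun z => a * deriv Ψ z) = fun z => a * deriv (deriv Ψ) z := by
    funext z
    exact deriv_const_mul_field a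
  refine ⟨h.1.const_mul a, fun z => ?_⟩
  rw [d, d']
  linear_combination a * h.2 z

theorem IsHeunEigen.comp_neg {c χ : ℝ} {Ψ : ℂ → ℂ} (h : IsHeunEigen c χ Ψ) :
    IsHeunEigen c χ (fun z => Ψ (-z)) := by
  have d : deriv (fun z => Ψ (-z)) = fun z => -deriv Ψ (-z) := by
    funext z
    exact deriv_comp_neg Ψ z
  have d' : deriv (fun z => -deriv Ψ (-z)) = fun z => deriv (deriv Ψ) (-z) := by
    funext z
    rw [deriv.fun_neg, deriv_comp_neg (deriv Ψ) z, neg_neg]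
  refine ⟨h.1.comp differentiable_neg, fun z => ?_⟩
  rw [d, d']
  linear_combination h.2 (-z)

/-- `Ψ(1) Ψ(-z) - Ψ(-1) Ψ(z)` is a solution vanishing at `1`, hence everywhere; its value at `-1`
gives `Ψ(1)² = Ψ(-1)²`. -/
theorem IsHeunEigen.parity {c χ : ℝ} {Ψ : ℂ → ℂ} (h : IsHeunEigen c χ Ψ) :
    ‖Ψ (-1)‖ = ‖Ψ 1‖ := by
  have h0 := ((h.comp_neg.const_mul (Ψ 1)).add (h.const_mul (-Ψ (-1)))).eq_zero (by ring) (-1)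
  have h1 : Ψ (-1) ^ 2 = Ψ 1 ^ 2 := by
    rw [neg_neg] at h0
    linear_combination -h0
  have h2 := congrArg norm h1
  rw [norm_pow, norm_pow] at h2
  exact (pow_left_inj₀ (norm_nonneg _) (norm_nonneg _) two_ne_zero).1 h2

/-- Energy estimate for real solutions of `T v = χ v`, `χ ≤ 0`, on `[0, 1]`. -/
theorem sq_le_of_heun_real {c χ : ℝ} (hχ : χ ≤ 0) {v v' v'' : ℝ → ℝ}
    (h1 : ∀ y, HasDerivAt v (v' y) y) (h2 : ∀ y, HasDerivAt v' (v'' y) y)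
    (ode : ∀ y, (1 - y ^ 2) * v'' y - 2 * y * v' y - c ^ 2 * y ^ 2 * v y = χ * v y)
    {y : ℝ} (hy : y ∈ Set.Icc (0 : ℝ) 1) :
    v y ^ 2 ≤ Real.exp (1 + (1 + c ^ 2) ^ 2) * v 1 ^ 2 := by
  set L : ℝ := 1 + (1 + c ^ 2) ^ 2 with hL
  have hm : 0 < 1 - χ := by linarith
  -- The weight `1/(1 - χ)` makes the terms `2χ v v'` cancel, which keeps the final constant
  -- independent of `χ`. At `y = 1` the term in `v'` disappears, leaving only `v 1`.
  have hF : ∀ y, HasDerivAt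
      (fun y => (v y ^ 2 + (1 - y ^ 2) * v' y ^ 2 / (1 - χ)) * Real.exp (L * y))
      ((2 * (1 + c ^ 2 * y ^ 2) * (v y * v' y) + 2 * y * v' y ^ 2
        + L * ((1 - χ) * v y ^ 2 + (1 - y ^ 2) * v' y ^ 2)) / (1 - χ) * Real.exp (L * y)) y := by
    intro y
    have e1 : HasDerivAt (fun y : ℝ => Real.exp (L * y)) (Real.exp (L * y) * L) y := by
      simpa using ((hasDerivAt_id y).const_mul L).exp
    have hsq : HasDerivAt (fun y : ℝ => y ^ 2) (2 * y) y := by simpa using hasDerivAt_pow 2 y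
    have hv2 : HasDerivAt (fun y : ℝ => v y ^ 2) (2 * v y * v' y) y := by
      simpa using (h1 y).fun_pow 2
    have hv3 : HasDerivAt (fun y : ℝ => v' y ^ 2) (2 * v' y * v'' y) y := by
      simpa using (h2 y).fun_pow 2
    refine ((hv2.add (((hsq.const_sub 1).mul hv3).div_const (1 - χ))).mul e1).congr_deriv ?_
    have o := ode y
    simp only [Pi.add_apply, Pi.mul_apply]
    field_simp
    linear_combination (2 * v' y) * o
  have hmono : MonotoneOn
      (fun y => (v y ^ 2 + (1 - y ^ 2) * v' y ^ 2 / (1 - χ)) * Real.exp (L * y))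
      (Set.Icc (0 : ℝ) 1) := by
    refine monotoneOn_of_deriv_nonneg (convex_Icc 0 1)
      (fun y _ => (hF y).continuousAt.continuousWithinAt)
      (fun y _ => (hF y).differentiableAt.differentiableWithinAt) fun y hy => ?_
    rw [interior_Icc] at hy
    rw [(hF y).deriv]
    refine mul_nonneg (div_nonneg ?_ hm.le) (Real.exp_pos _).le
    have a1 : 0 ≤ 1 - y ^ 2 := by nlinarith [hy.1, hy.2]
    have a2 : (1 + c ^ 2 * y ^ 2) ^ 2 ≤ L := by
      have : 1 + c ^ 2 * y ^ 2 ≤ 1 + c ^ 2 := by nlinarith [sq_nonneg c]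
      have : (1 + c ^ 2 * y ^ 2) ^ 2 ≤ (1 + c ^ 2) ^ 2 := by gcongr
      linarith
    have a3 : 1 ≤ L := by rw [hL]; nlinarith [sq_nonneg (1 + c ^ 2)]
    have b1 : (1 + c ^ 2 * y ^ 2) ^ 2 * v y ^ 2 ≤ L * ((1 - χ) * v y ^ 2) := by
      have : v y ^ 2 ≤ (1 - χ) * v y ^ 2 := by nlinarith [sq_nonneg (v y)]
      exact mul_le_mul a2 this (sq_nonneg _) (by linarith)
    have b2 : (1 - y ^ 2) * v' y ^ 2 ≤ L * ((1 - y ^ 2) * v' y ^ 2) :=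
      le_mul_of_one_le_left (mul_nonneg a1 (sq_nonneg _)) a3
    have b3 : y ^ 2 * v' y ^ 2 ≤ 2 * y * v' y ^ 2 :=
      mul_le_mul_of_nonneg_right (by nlinarith [hy.1, hy.2]) (sq_nonneg _)
    -- The cross term is absorbed by this square, with `v'² = (1 - y²) v'² + y² v'²` split between
    -- `b2` and `b3`; `L` was chosen for `b1` and `b2`.
    nlinarith [sq_nonneg (v' y + (1 + c ^ 2 * y ^ 2) * v y)]
  have h := hmono hy (Set.right_mem_Icc.2 zero_le_one) hy.2
  simp only [one_pow, sub_self, zero_mul, zero_div, add_zero, mul_one] at h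
  have a1 : 0 ≤ (1 - y ^ 2) * v' y ^ 2 / (1 - χ) :=
    div_nonneg (mul_nonneg (by nlinarith [hy.1, hy.2]) (sq_nonneg _)) hm.le
  have a2 : 1 ≤ Real.exp (L * y) := Real.one_le_exp (mul_nonneg (by positivity) hy.1)
  calc v y ^ 2 ≤ v y ^ 2 + (1 - y ^ 2) * v' y ^ 2 / (1 - χ) := by linarith
    _ ≤ _ := le_mul_of_one_le_right (by positivity) a2
    _ ≤ _ := h
    _ = _ := mul_comm _ _

/-- A bound, uniform in the eigenvalue, for normalised eigenfunctions of the Heun operator. -/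
noncomputable def heunBound (c : ℝ) : ℝ := Real.exp ((1 + (1 + c ^ 2) ^ 2) / 2)

/-- The equation has real coefficients on the real axis, so the real and imaginary parts of `Ψ`
satisfy it separately and the two squared bounds add up. -/
theorem IsHeunEigen.norm_le_of_nonneg {c χ : ℝ} (hχ : χ ≤ 0) {Ψ : ℂ → ℂ} (h : IsHeunEigen c χ Ψ)
    {y : ℝ} (hy : y ∈ Set.Icc (0 : ℝ) 1) : ‖Ψ y‖ ≤ heunBound c * ‖Ψ 1‖ := by
  have d1 : ∀ y : ℝ, HasDerivAt (fun y : ℝ => Ψ y) (deriv Ψ y) y := fun y =>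
    (h.1 y).hasDerivAt.comp_ofReal
  have d2 : ∀ y : ℝ, HasDerivAt (fun y : ℝ => deriv Ψ y) (deriv (deriv Ψ) y) y := fun y =>
    (h.1.deriv y).hasDerivAt.comp_ofReal
  have ode : ∀ y : ℝ, ((1 - y ^ 2 : ℝ) : ℂ) * deriv (deriv Ψ) y - ((2 * y : ℝ) : ℂ) * deriv Ψ y
      - ((c ^ 2 * y ^ 2 : ℝ) : ℂ) * Ψ y = (χ : ℂ) * Ψ y := fun y => by
    push_cast
    exact h.2 y
  have hre := sq_le_of_heun_real (c := c) hχ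
    (fun y => Complex.reCLM.hasFDerivAt.comp_hasDerivAt y (d1 y))
    (fun y => Complex.reCLM.hasFDerivAt.comp_hasDerivAt y (d2 y))
    (fun y => by
      have o := congrArg Complex.re (ode y)
      simp only [Complex.sub_re, Complex.re_ofReal_mul] at o
      exact o) hy
  have him := sq_le_of_heun_real (c := c) hχ
    (fun y => Complex.imCLM.hasFDerivAt.comp_hasDerivAt y (d1 y))
    (fun y => Complex.imCLM.hasFDerivAt.comp_hasDerivAt y (d2 y))
    (fun y => by
      have o := congrArg Complex.im (ode y)
      simp only [Complex.sub_im, Complex.im_ofReal_mul] at o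
      exact o) hy
  simp only [Function.comp_apply, Complex.reCLM_apply, Complex.imCLM_apply,
    Complex.ofReal_one] at hre him
  refine le_of_sq_le_sq ?_ (mul_nonneg (Real.exp_pos _).le (norm_nonneg _))
  have he : heunBound c ^ 2 = Real.exp (1 + (1 + c ^ 2) ^ 2) := by
    rw [heunBound, ← Real.exp_nat_mul]
    congr 1
    push_cast
    ring
  rw [mul_pow, he, Complex.sq_norm, Complex.sq_norm, Complex.normSq_apply, Complex.normSq_apply]
  nlinarith

theorem IsHeunEigen.norm_le {c χ : ℝ} (hχ : χ ≤ 0) {Ψ : ℂ → ℂ} (h : IsHeunEigen c χ Ψ)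
    {y : ℝ} (hy : y ∈ Set.Icc (-1 : ℝ) 1) : ‖Ψ y‖ ≤ heunBound c * ‖Ψ 1‖ := by
  rcases le_total 0 y with h0 | h0
  · exact h.norm_le_of_nonneg hχ ⟨h0, hy.2⟩
  · have := h.comp_neg.norm_le_of_nonneg hχ (y := -y) ⟨by linarith, by linarith [hy.1]⟩
    rw [h.parity] at this
    simpa using this

/-! ### Integral transforms with kernel `κ (x t)` -/

/-- The transform `z ↦ ∫ κ (z t) φ t dt` over `[-1, 1]`. -/
noncomputable def kerT (κ : ℂ → ℂ) (φ : ℝ → ℂ) (z : ℂ) : ℂ := ∫ t, κ (z * t) * φ t ∂muI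

theorem ae_muI_abs_le : ∀ᵐ t ∂muI, |t| ≤ 1 :=
  ae_restrict_of_forall_mem measurableSet_Icc fun _ ht => abs_le.2 ht

theorem integrable_continuous_mul {g : ℝ → ℂ} (hg : Continuous g) {φ : ℝ → ℂ}
    (hφ : Integrable φ muI) : Integrable (fun t => g t * φ t) muI := by
  obtain ⟨C, hC⟩ := isCompact_Icc.exists_bound_of_continuousOn
    (hg.continuousOn (s := Set.Icc (-1 : ℝ) 1))
  exact hφ.bdd_mul hg.aestronglyMeasurable (ae_restrict_of_forall_mem measurableSet_Icc hC)

theorem integrable_kernel_mul {κ : ℂ → ℂ} (hκ : Continuous κ) {φ : ℝ → ℂ}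
    (hφ : Integrable φ muI) (z : ℂ) : Integrable (fun t : ℝ => κ (z * t) * φ t) muI :=
  integrable_continuous_mul (by fun_prop) hφ

/-- The derivative is again a transform of the same type, with kernel `deriv κ` and density `t
φ(t)`, so the formula can be iterated. -/
theorem hasDerivAt_kerT {κ : ℂ → ℂ} (hκ : Differentiable ℂ κ) {φ : ℝ → ℂ}
    (hφ : Integrable φ muI) (z : ℂ) :
    HasDerivAt (kerT κ φ) (kerT (deriv κ) (fun t => t * φ t) z) z := by
  have hd : Continuous (deriv κ) := hκ.deriv.continuous
  obtain ⟨C, hC⟩ := (isCompact_closedBall (0 : ℂ) (‖z‖ + 1)).exists_bound_of_continuousOn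
    hd.continuousOn
  have hφ' : Integrable (fun t : ℝ => (t : ℂ) * φ t) muI :=
    integrable_continuous_mul Complex.continuous_ofReal hφ
  refine (hasDerivAt_integral_of_dominated_loc_of_deriv_le (μ := muI)
    (F := fun z (t : ℝ) => κ (z * t) * φ t)
    (F' := fun z (t : ℝ) => deriv κ (z * t) * (t * φ t))
    (bound := fun t => C * ‖(t : ℂ) * φ t‖) (Metric.ball_mem_nhds z one_pos)
    (Eventually.of_forall fun w => (integrable_kernel_mul hκ.continuous hφ w).aestronglyMeasurable)
    (integrable_kernel_mul hκ.continuous hφ z)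
    (integrable_kernel_mul hd hφ' z).aestronglyMeasurable ?_ (hφ'.norm.const_mul C) ?_).2
  · filter_upwards [ae_muI_abs_le] with t ht w hw
    rw [norm_mul]
    refine mul_le_mul_of_nonneg_right (hC _ ?_) (norm_nonneg _)
    rw [mem_closedBall_zero_iff, norm_mul, Complex.norm_real, Real.norm_eq_abs]
    have h1 : ‖w‖ ≤ ‖z‖ + 1 := by
      have := norm_sub_norm_le w z
      rw [Metric.mem_ball, dist_eq_norm] at hw
      linarith
    calc ‖w‖ * |t| ≤ ‖w‖ * 1 := by gcongr
      _ ≤ _ := by rwa [mul_one]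
  · refine Eventually.of_forall fun t w _ => ?_
    have h := (((hκ (w * t)).hasDerivAt.comp w ((hasDerivAt_id w).mul_const (t : ℂ))).mul_const
      (φ t))
    refine h.congr_deriv ?_
    ring

theorem differentiable_kerT {κ : ℂ → ℂ} (hκ : Differentiable ℂ κ) {φ : ℝ → ℂ}
    (hφ : Integrable φ muI) : Differentiable ℂ (kerT κ φ) := fun z =>
  (hasDerivAt_kerT hκ hφ z).differentiableAt

theorem contDiff_comp_ofReal {Ψ : ℂ → ℂ} (h : Differentiable ℂ Ψ) :
    ContDiff ℝ (⊤ : ℕ∞) (fun x : ℝ => Ψ x) :=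
  ((h.contDiff (n := (⊤ : ℕ∞))).restrict_scalars ℝ).comp Complex.ofRealCLM.contDiff

/-- The restriction to the real line of an entire function. -/
noncomputable def realRestrict (Ψ : ℂ → ℂ) (h : Differentiable ℂ Ψ) : SmoothFun :=
  ⟨fun x : ℝ => Ψ x, contDiff_comp_ofReal h⟩

theorem kerT_congr (κ : ℂ → ℂ) {φ ψ : ℝ → ℂ} (h : φ =ᵐ[muI] ψ) (z : ℂ) :
    kerT κ φ z = kerT κ ψ z := by
  refine integral_congr_ae ?_
  filter_upwards [h] with t ht
  rw [ht]

theorem integrable_L2I (φ : L2I) : Integrable φ muI := (Lp.memLp φ).integrable (by norm_num)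

/-- A constant dominating the `L²` norm on `[-1, 1]` by the supremum norm. -/
noncomputable def l2Const : ℝ := (measureUnivNNReal muI : ℝ) ^ ((2 : ENNReal).toReal⁻¹)

theorem l2Const_nonneg : 0 ≤ l2Const := Real.rpow_nonneg (NNReal.coe_nonneg _) _

theorem norm_smoothToL2_le {f : SmoothFun} {M : ℝ} (hM : 0 ≤ M)
    (h : ∀ x ∈ Set.Icc (-1 : ℝ) 1, ‖(f : ℝ → ℂ) x‖ ≤ M) : ‖smoothToL2 f‖ ≤ l2Const * M := by
  refine Lp.norm_le_of_ae_bound hM ?_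
  filter_upwards [coeFn_smoothToL2 f, ae_restrict_of_forall_mem measurableSet_Icc h] with x h1 h2
  rwa [h1]

theorem norm_kerT_le {κ : ℂ → ℂ} (hκ : Differentiable ℂ κ) {M : ℝ} (hM : 0 ≤ M)
    (h : ∀ w : ℂ, ‖w‖ ≤ 1 → ‖κ w‖ ≤ M) (φ : L2I) {x : ℝ} (hx : x ∈ Set.Icc (-1 : ℝ) 1) :
    ‖kerT κ φ x‖ ≤ l2Const * M * ‖φ‖ := by
  have hd : Differentiable ℂ fun t : ℂ => κ (x * t) := hκ.comp (differentiable_id.const_mul _)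
  set f : SmoothFun := ⟨fun t => star (κ (x * t)), contDiff_conj (contDiff_comp_ofReal hd)⟩ with hf
  have e : kerT κ φ x = inner ℂ (smoothToL2 f) φ := by
    rw [inner_smoothToL2_left]
    simp [hf, kerT]
  rw [e]
  refine (norm_inner_le_norm _ _).trans (mul_le_mul_of_nonneg_right ?_ (norm_nonneg _))
  refine norm_smoothToL2_le hM fun t ht => ?_
  rw [hf]
  simp only [norm_star]
  refine h _ ?_
  rw [norm_mul, Complex.norm_real, Complex.norm_real]
  exact mul_le_one₀ (abs_le.2 hx) (norm_nonneg _) (abs_le.2 ht)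

theorem exists_bound_closedBall {κ : ℂ → ℂ} (hκ : Continuous κ) :
    ∃ M : ℝ, 0 ≤ M ∧ ∀ w : ℂ, ‖w‖ ≤ 1 → ‖κ w‖ ≤ M := by
  obtain ⟨C, hC⟩ := (isCompact_closedBall (0 : ℂ) 1).exists_bound_of_continuousOn
    hκ.continuousOn
  refine ⟨C, (norm_nonneg _).trans (hC 0 (by simp)), fun w hw => hC w ?_⟩
  rwa [mem_closedBall_zero_iff]

/-- The transform with kernel `κ (x t)` as a linear map into smooth functions. -/
noncomputable def kerSmooth (κ : ℂ → ℂ) (hκ : Differentiable ℂ κ) : L2I →ₗ[ℂ] SmoothFun where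
  toFun φ := realRestrict (kerT κ φ) (differentiable_kerT hκ (integrable_L2I φ))
  map_add' φ ψ := by
    refine Subtype.ext (funext fun x => ?_)
    change kerT κ _ _ = kerT κ _ _ + kerT κ _ _
    rw [kerT_congr κ (Lp.coeFn_add φ ψ), kerT, kerT, kerT,
      ← integral_add (integrable_kernel_mul hκ.continuous (integrable_L2I φ) _)
        (integrable_kernel_mul hκ.continuous (integrable_L2I ψ) _)]
    simp_rw [Pi.add_apply, mul_add]
  map_smul' a φ := by
    refine Subtype.ext (funext fun x => ?_)
    change kerT κ _ _ = a • kerT κ _ _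
    rw [kerT_congr κ (Lp.coeFn_smul a φ), kerT, kerT, ← integral_smul]
    simp_rw [Pi.smul_apply, mul_smul_comm]

/-- The integral operator on `L²[-1, 1]` with kernel `κ (x t)`. -/
noncomputable def kerOp (κ : ℂ → ℂ) (hκ : Differentiable ℂ κ) : L2I →L[ℂ] L2I :=
  LinearMap.mkContinuousOfExistsBound (smoothToL2 ∘ₗ kerSmooth κ hκ) (by
    obtain ⟨M, hM, h⟩ := exists_bound_closedBall hκ.continuous
    refine ⟨l2Const * (l2Const * M), fun φ => ?_⟩
    rw [mul_assoc]
    exact norm_smoothToL2_le (mul_nonneg (mul_nonneg l2Const_nonneg hM) (norm_nonneg _))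
      fun x hx => norm_kerT_le hκ hM h φ hx)

theorem kerOp_apply (κ : ℂ → ℂ) (hκ : Differentiable ℂ κ) (φ : L2I) :
    kerOp κ hκ φ = smoothToL2 (kerSmooth κ hκ φ) := rfl

theorem kerSmooth_apply (κ : ℂ → ℂ) (hκ : Differentiable ℂ κ) (φ : L2I) (x : ℝ) :
    (kerSmooth κ hκ φ : ℝ → ℂ) x = kerT κ φ x := rfl

theorem norm_kerOp_sub_le {κ κ' : ℂ → ℂ} (hκ : Differentiable ℂ κ) (hκ' : Differentiable ℂ κ')
    {M : ℝ} (hM : 0 ≤ M) (h : ∀ w : ℂ, ‖w‖ ≤ 1 → ‖κ w - κ' w‖ ≤ M) :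
    ‖kerOp κ hκ - kerOp κ' hκ'‖ ≤ l2Const * (l2Const * M) := by
  refine ContinuousLinearMap.opNorm_le_bound _ (mul_nonneg l2Const_nonneg
    (mul_nonneg l2Const_nonneg hM)) fun φ => ?_
  rw [sub_apply, kerOp_apply, kerOp_apply, ← map_sub, mul_assoc]
  refine norm_smoothToL2_le (mul_nonneg (mul_nonneg l2Const_nonneg hM) (norm_nonneg _))
    fun x hx => ?_
  have e : kerT κ φ x - kerT κ' φ x = kerT (fun w => κ w - κ' w) φ x := by
    rw [kerT, kerT, kerT, ← integral_sub (integrable_kernel_mul hκ.continuous (integrable_L2I φ) _)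
            (integrable_kernel_mul hκ'.continuous (integrable_L2I φ) _)]
    simp_rw [sub_mul]
  change ‖kerT κ φ x - kerT κ' φ x‖ ≤ _
  rw [e]
  exact norm_kerT_le (hκ.sub hκ') hM h φ hx

theorem isCompactOperator_of_range_le {T : L2I →L[ℂ] L2I} (S : Submodule ℂ L2I)
    [FiniteDimensional ℂ S] (h : ∀ φ, T φ ∈ S) : IsCompactOperator T := by
  have : IsCompactOperator (T.codRestrict S h) :=
    isCompactOperator_of_locallyCompactSpace_dom (T.codRestrict S h)
  exact this.clm_comp S.subtypeL

/-- Each `(xt)ⁿ` separates as `xⁿ tⁿ`, so the operator has finite rank, with range in the span of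
finitely many monomials. -/
theorem isCompactOperator_kerOp_polynomial (a : ℕ → ℂ) (N : ℕ)
    (h : Differentiable ℂ fun w : ℂ => ∑ n ∈ Finset.range N, a n * w ^ n) :
    IsCompactOperator (kerOp (fun w => ∑ n ∈ Finset.range N, a n * w ^ n) h) := by
  classical
  let m : ℕ → SmoothFun := fun n => realRestrict (fun z => z ^ n) (by fun_prop)
  refine isCompactOperator_of_range_le
    (Submodule.span ℂ (((Finset.range N).image fun n => smoothToL2 (m n) : Finset L2I) : Set L2I))
    fun φ => ?_
  have e : kerOp (fun w => ∑ n ∈ Finset.range N, a n * w ^ n) h φ =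
      ∑ n ∈ Finset.range N, (a n * ∫ t : ℝ, (t : ℂ) ^ n * φ t ∂muI) • smoothToL2 (m n) := by
    simp_rw [← map_smul, ← map_sum]
    rw [kerOp_apply]
    refine congrArg _ (Subtype.ext (funext fun x => ?_))
    simp only [Submodule.coe_sum, Finset.sum_apply]
    change ∫ t : ℝ, (∑ n ∈ Finset.range N, a n * ((x : ℂ) * t) ^ n) * φ t ∂muI =
      ∑ n ∈ Finset.range N, (a n * ∫ t : ℝ, (t : ℂ) ^ n * φ t ∂muI) * (x : ℂ) ^ n
    have e1 : ∀ t : ℝ, (∑ n ∈ Finset.range N, a n * ((x : ℂ) * t) ^ n) * φ t =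
        ∑ n ∈ Finset.range N, (a n * (x : ℂ) ^ n) * ((t : ℂ) ^ n * φ t) := fun t => by
      rw [Finset.sum_mul]
      exact Finset.sum_congr rfl fun n _ => by ring
    simp_rw [e1]
    rw [integral_finsetSum _ fun n _ => (integrable_continuous_mul (by fun_prop)
      (integrable_L2I φ)).const_mul _]
    refine Finset.sum_congr rfl fun n _ => ?_
    rw [integral_const_mul]
    ring
  rw [e]
  exact Submodule.sum_mem _ fun n hn => Submodule.smul_mem _ _ (Submodule.subset_span
    (Finset.mem_coe.2 (Finset.mem_image_of_mem _ hn)))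

/-- The Taylor polynomials of `κ` converge uniformly on the closed unit disc, which contains every
`xt`; the operator is a norm limit of finite-rank ones. -/
theorem isCompactOperator_kerOp {κ : ℂ → ℂ} (hκ : Differentiable ℂ κ) :
    IsCompactOperator (kerOp κ hκ) := by
  set a : ℕ → ℂ := fun n => (n.factorial : ℂ)⁻¹ * iteratedDeriv n κ 0 with ha
  have hs : ∀ w : ℂ, HasSum (fun n => a n * w ^ n) (κ w) := fun w => by
    refine (Complex.hasSum_taylorSeries_of_entire hκ 0 w).congr_fun fun n => ?_
    rw [smul_eq_mul, smul_eq_mul, sub_zero, ha]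
    ring
  have hu : Summable fun n => ‖a n‖ := by simpa using (hs 1).summable.norm
  have hU := tendstoUniformlyOn_tsum_nat (f := fun n (w : ℂ) => a n * w ^ n) hu
    (s := Metric.closedBall (0 : ℂ) 1) fun n w hw => by
      rw [norm_mul, norm_pow]
      exact mul_le_of_le_one_right (norm_nonneg _)
        (pow_le_one₀ (norm_nonneg _) (mem_closedBall_zero_iff.1 hw))
  have hd : ∀ N : ℕ, Differentiable ℂ fun w : ℂ => ∑ n ∈ Finset.range N, a n * w ^ n := fun N => by
    fun_prop
  refine isCompactOperator_of_tendsto (l := atTop)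
    (F := fun N : ℕ => kerOp (fun w => ∑ n ∈ Finset.range N, a n * w ^ n) (hd N)) ?_
    (Eventually.of_forall fun N => isCompactOperator_kerOp_polynomial a N (hd N))
  rw [Metric.tendsto_atTop]
  intro ε hε
  have hC : 0 < l2Const * l2Const + 1 := by nlinarith [l2Const_nonneg]
  obtain ⟨N, hN⟩ := eventually_atTop.1 (Metric.tendstoUniformlyOn_iff.1 hU
    (ε / (l2Const * l2Const + 1)) (div_pos hε hC))
  refine ⟨N, fun n hn => ?_⟩
  rw [dist_comm, dist_eq_norm]
  refine (norm_kerOp_sub_le hκ (hd n) (div_pos hε hC).le fun w hw => ?_).trans_lt ?_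
  · have := hN n hn w (mem_closedBall_zero_iff.2 hw)
    rw [(hs w).tsum_eq, dist_eq_norm] at this
    exact this.le
  · rw [← mul_assoc, mul_div_assoc', div_lt_iff₀ hC]
    nlinarith

theorem integral_mul_integral_comm {k : ℝ → ℝ → ℂ} (hk : Continuous (Function.uncurry k))
    {φ ψ : ℝ → ℂ} (hφ : Integrable φ muI) (hψ : Integrable ψ muI) :
    ∫ x, ψ x * ∫ t, k x t * φ t ∂muI ∂muI = ∫ t, φ t * ∫ x, k x t * ψ x ∂muI ∂muI := by
  simp_rw [← integral_const_mul]
  rw [integral_integral_swap]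
  · refine integral_congr_ae (Eventually.of_forall fun t => ?_)
    refine integral_congr_ae (Eventually.of_forall fun x => ?_)
    simp only
    ring
  · obtain ⟨C, hC⟩ := (isCompact_Icc.prod isCompact_Icc).exists_bound_of_continuousOn
      (hk.continuousOn (s := Set.Icc (-1 : ℝ) 1 ×ˢ Set.Icc (-1 : ℝ) 1))
    have hb : ∀ᵐ p ∂(muI.prod muI), ‖Function.uncurry k p‖ ≤ C := by
      rw [muI, Measure.prod_restrict]
      exact ae_restrict_of_forall_mem (measurableSet_Icc.prod measurableSet_Icc) hC
    refine ((hψ.mul_prod hφ).bdd_mul hk.aestronglyMeasurable hb).congr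
      (Eventually.of_forall fun p => ?_)
    simp only [Function.uncurry]
    ring

/-- The kernel `κ(xt)` is symmetric in `x` and `t` and real on the real axis, so this is Fubini's
theorem. -/
theorem inner_kerOp {κ : ℂ → ℂ} (hκ : Differentiable ℂ κ) (hr : ∀ x : ℝ, star (κ x) = κ x)
    (φ ψ : L2I) : inner ℂ (kerOp κ hκ φ) ψ = inner ℂ φ (kerOp κ hκ ψ) := by
  have h1 : inner ℂ (kerOp κ hκ φ) ψ = ∫ x, ψ x * ∫ t, κ (x * t) * star (φ t) ∂muI ∂muI := by
    rw [kerOp_apply, inner_smoothToL2_left]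
    refine integral_congr_ae (Eventually.of_forall fun x => ?_)
    change star (∫ t : ℝ, κ (x * t) * φ t ∂muI) * ψ x = _
    have : star (∫ t : ℝ, κ (x * t) * φ t ∂muI) = ∫ t : ℝ, star (κ (x * t) * φ t) ∂muI :=
      integral_conj.symm
    rw [this, mul_comm]
    congr 2
    funext t
    rw [star_mul', ← Complex.ofReal_mul, hr]
  have h2 : inner ℂ φ (kerOp κ hκ ψ) = ∫ t, star (φ t) * ∫ x, κ (t * x) * ψ x ∂muI ∂muI := by
    rw [L2.inner_def]
    refine integral_congr_ae ?_
    filter_upwards [coeFn_smoothToL2 (kerSmooth κ hκ ψ)] with x hx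
    rw [kerOp_apply, hx, RCLike.inner_apply, mul_comm]
    rfl
  have hi : Integrable (fun t => star (φ t)) muI := by
    have h := integrable_L2I φ
    refine ⟨continuous_star.comp_aestronglyMeasurable h.1, ?_⟩
    have h2 := h.2
    rw [hasFiniteIntegral_iff_norm] at h2 ⊢
    simpa only [norm_star] using h2
  rw [h1, h2]
  have := integral_mul_integral_comm (k := fun x t : ℝ => κ (x * t))
    (by have := hκ.continuous; fun_prop) hi (integrable_L2I ψ)
  rw [this]
  simp_rw [mul_comm (Complex.ofReal _) (Complex.ofReal _)]

/-! ### The Hartley kernel -/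

/-- The function `w ↦ cos (c w) + sin (c w)`. -/
noncomputable def hartley (c : ℝ) (w : ℂ) : ℂ := Complex.cos (c * w) + Complex.sin (c * w)

theorem hasDerivAt_hartley (c : ℝ) (w : ℂ) :
    HasDerivAt (hartley c) (c * (Complex.cos (c * w) - Complex.sin (c * w))) w := by
  have h : HasDerivAt (fun w : ℂ => (c : ℂ) * w) c w := by
    simpa using (hasDerivAt_id w).const_mul (c : ℂ)
  refine (h.ccos.add h.csin).congr_deriv ?_
  ring

theorem differentiable_hartley (c : ℝ) : Differentiable ℂ (hartley c) := fun w =>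
  (hasDerivAt_hartley c w).differentiableAt

theorem deriv_hartley (c : ℝ) :
    deriv (hartley c) = fun w => c * (Complex.cos (c * w) - Complex.sin (c * w)) :=
  funext fun w => (hasDerivAt_hartley c w).deriv

theorem deriv_deriv_hartley (c : ℝ) :
    deriv (deriv (hartley c)) = fun w => -(c : ℂ) ^ 2 * hartley c w := by
  rw [deriv_hartley]
  funext w
  have h : HasDerivAt (fun w : ℂ => (c : ℂ) * w) c w := by
    simpa using (hasDerivAt_id w).const_mul (c : ℂ)
  have hd : HasDerivAt (fun w : ℂ => (c : ℂ) * (Complex.cos (c * w) - Complex.sin (c * w)))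
      (-(c : ℂ) ^ 2 * hartley c w) w := by
    refine ((h.ccos.sub h.csin).const_mul (c : ℂ)).congr_deriv ?_
    rw [hartley]
    ring
  exact hd.deriv

theorem star_hartley (c : ℝ) (x : ℝ) : star (hartley c x) = hartley c x := by
  rw [hartley, ← Complex.ofReal_mul, ← Complex.ofReal_cos, ← Complex.ofReal_sin,
    ← Complex.ofReal_add]
  exact Complex.conj_ofReal _

/-- Every moment of `φ` is visible to the transform only because no Taylor coefficient of the kernel
vanishes; cosine or sine alone would lose half of them. -/
theorem iteratedDeriv_hartley_zero_ne {c : ℝ} (hc : c ≠ 0) (n : ℕ) :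
    iteratedDeriv n (hartley c) 0 ≠ 0 := by
  have hc' : (c : ℂ) ≠ 0 := Complex.ofReal_ne_zero.2 hc
  induction n using Nat.twoStepInduction with
  | zero => simp [hartley]
  | one => simp [iteratedDeriv_one, deriv_hartley, hc']
  | more n ih _ =>
    rw [iteratedDeriv_succ', iteratedDeriv_succ', deriv_deriv_hartley]
    have := iteratedDeriv_const_mul_field (-(c : ℂ) ^ 2) (hartley c) (n := n) (x := (0 : ℂ))
    rw [this]
    exact mul_ne_zero (neg_ne_zero.2 (pow_ne_zero _ hc')) ih

theorem kerT_iteratedDeriv_eq_zero {κ : ℂ → ℂ} (hκ : Differentiable ℂ κ) {φ : ℝ → ℂ}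
    (hφ : Integrable φ muI) (h : ∀ z, kerT κ φ z = 0) (n : ℕ) :
    ∀ z, kerT (iteratedDeriv n κ) (fun t => (t : ℂ) ^ n * φ t) z = 0 := by
  induction n with
  | zero => simpa using h
  | succ n ih =>
    intro z
    have hd : Differentiable ℂ (iteratedDeriv n κ) := fun w =>
      (hasDerivAt_iteratedDeriv hκ n w).differentiableAt
    have h1 := hasDerivAt_kerT hd (integrable_continuous_mul (g := fun t : ℝ => (t : ℂ) ^ n)
      (by fun_prop) hφ) z
    have h2 := h1.unique ((hasDerivAt_const z (0 : ℂ)).congr_of_eventuallyEq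
      (Eventually.of_forall fun w => ih w))
    rw [← iteratedDeriv_succ] at h2
    rw [← h2]
    congr 1
    funext t
    ring

/-- By Weierstrass approximation on `[-1, 1]`, orthogonality to polynomials passes to smooth test
functions. -/
theorem ae_eq_zero_of_moments {φ : ℝ → ℂ} (hφ : Integrable φ muI)
    (h : ∀ n : ℕ, ∫ t : ℝ, (t : ℂ) ^ n * φ t ∂muI = 0) : φ =ᵐ[muI] 0 := by
  have hpoly : ∀ p : Polynomial ℝ, ∫ t : ℝ, ((p.eval t : ℝ) : ℂ) * φ t ∂muI = 0 := fun p => by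
    have e : ∀ t : ℝ, ((p.eval t : ℝ) : ℂ) * φ t =
        ∑ n ∈ p.support, (p.coeff n : ℂ) * ((t : ℂ) ^ n * φ t) := fun t => by
      rw [Polynomial.eval_eq_sum, Polynomial.sum, Complex.ofReal_sum, Finset.sum_mul]
      exact Finset.sum_congr rfl fun n _ => by push_cast; ring
    simp_rw [e]
    rw [integral_finsetSum _ fun n _ => (integrable_continuous_mul (by fun_prop) hφ).const_mul _]
    exact Finset.sum_eq_zero fun n _ => by rw [integral_const_mul, h, mul_zero]
  refine ae_eq_zero_of_integral_contDiff_smul_eq_zero hφ.locallyIntegrable fun g hg _ => ?_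
  have hgc := hg.continuous
  refine norm_le_zero_iff.1 (le_of_forall_pos_le_add fun ε hε => ?_)
  set A := ∫ t, ‖φ t‖ ∂muI with hA
  have hA0 : 0 ≤ A := integral_nonneg fun t => norm_nonneg _
  obtain ⟨p, hp⟩ := exists_polynomial_near_of_continuousOn (-1) 1 g hgc.continuousOn
    (ε / (A + 1)) (by positivity)
  have hi1 : Integrable (fun t => ((g t : ℝ) : ℂ) * φ t) muI :=
    integrable_continuous_mul (by fun_prop) hφ
  have hi2 : Integrable (fun t => ((p.eval t : ℝ) : ℂ) * φ t) muI :=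
    integrable_continuous_mul (Complex.continuous_ofReal.comp p.continuous) hφ
  have e : ∫ t, g t • φ t ∂muI =
      ∫ t, (((g t : ℝ) : ℂ) * φ t - ((p.eval t : ℝ) : ℂ) * φ t) ∂muI := by
    rw [integral_sub hi1 hi2, hpoly, sub_zero]
    rfl
  rw [e, zero_add]
  calc _ ≤ ∫ t, ε / (A + 1) * ‖φ t‖ ∂muI := by
        refine norm_integral_le_of_norm_le (hφ.norm.const_mul _)
          (ae_restrict_of_forall_mem measurableSet_Icc fun t ht => ?_)
        rw [← sub_mul, norm_mul, ← Complex.ofReal_sub, Complex.norm_real, norm_sub_rev]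
        exact mul_le_mul_of_nonneg_right (hp t ht).le (norm_nonneg _)
    _ = ε / (A + 1) * A := integral_const_mul _ _
    _ ≤ ε := by
        rw [div_mul_eq_mul_div, div_le_iff₀ (by positivity)]
        nlinarith

/-- Identity theorem for entire functions vanishing on `[-1, 1]`. -/
theorem eq_zero_of_eqOn_Icc {F : ℂ → ℂ} (hF : Differentiable ℂ F)
    (h0 : ∀ x ∈ Set.Icc (-1 : ℝ) 1, F x = 0) (z : ℂ) : F z = 0 := by
  have han : AnalyticOnNhd ℂ F Set.univ := hF.differentiableOn.analyticOnNhd isOpen_univ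
  have hf : ∃ᶠ z in 𝓝[≠] (0 : ℂ), F z = 0 := by
    have ht : Tendsto (fun n : ℕ => ((1 / ((n : ℝ) + 1) : ℝ) : ℂ)) atTop (𝓝[≠] 0) := by
      refine tendsto_nhdsWithin_iff.2 ⟨?_, Eventually.of_forall fun n => ?_⟩
      · rw [← Complex.ofReal_zero]
        exact (Complex.continuous_ofReal.tendsto 0).comp tendsto_one_div_add_atTop_nhds_zero_nat
      · exact Complex.ofReal_ne_zero.2 (by positivity)
    refine ht.frequently (Frequently.of_forall fun n => h0 _ ⟨?_, ?_⟩)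
    · have : (0 : ℝ) ≤ 1 / ((n : ℝ) + 1) := by positivity
      linarith
    · rw [div_le_one (by positivity)]
      linarith [(Nat.cast_nonneg n : (0 : ℝ) ≤ n)]
  exact han.eqOn_zero_of_preconnected_of_frequently_eq_zero isPreconnected_univ
    (Set.mem_univ 0) hf (Set.mem_univ z)

/-- The transform of `φ` is entire and vanishes on `[-1, 1]`, hence everywhere. Its `n`-th
derivative at `0` is a nonzero multiple of the `n`-th moment of `φ`. -/
theorem kerOp_hartley_injective {c : ℝ} (hc : c ≠ 0) {φ : L2I}
    (h : kerOp (hartley c) (differentiable_hartley c) φ = 0) : φ = 0 := by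
  have hi := integrable_L2I φ
  have hd := differentiable_kerT (differentiable_hartley c) hi
  rw [kerOp_apply, ← map_zero smoothToL2] at h
  have h0 := eqOn_of_smoothToL2_eq h
  have hz : ∀ z, kerT (hartley c) φ z = 0 := eq_zero_of_eqOn_Icc hd fun x hx => h0 hx
  have hm : φ =ᵐ[muI] 0 := by
    refine ae_eq_zero_of_moments hi fun n => ?_
    have := kerT_iteratedDeriv_eq_zero (differentiable_hartley c) hi hz n 0
    rw [kerT] at this
    simp only [zero_mul] at this
    rw [integral_const_mul] at this
    exact (mul_eq_zero.1 this).resolve_left (iteratedDeriv_hartley_zero_ne hc n)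
  exact (Lp.eq_zero_iff_ae_eq_zero).2 hm

/-- The Hartley transform commutes with the Heun operator. -/
theorem kerT_hartley_heunExpr (c : ℝ) {f : ℝ → ℂ} (hf : ContDiff ℝ (⊤ : ℕ∞) f) (x : ℝ) :
    kerT (hartley c) (heunExpr c f) x = heunExpr c (fun y : ℝ => kerT (hartley c) f y) x := by
  have hκ := differentiable_hartley c
  have hint : ∀ g : ℝ → ℂ, Continuous g → Integrable g muI := fun g hg =>
    hg.continuousOn.integrableOn_compact isCompact_Icc
  have hfc := hf.continuous
  have hF1 : ∀ y : ℝ, HasDerivAt (fun y : ℝ => kerT (hartley c) f y)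
      (kerT (deriv (hartley c)) (fun t => t * f t) y) y := fun y =>
    (hasDerivAt_kerT hκ (hint f hfc) y).comp_ofReal
  have hF2 : ∀ y : ℝ, HasDerivAt (fun y : ℝ => kerT (deriv (hartley c)) (fun t => t * f t) y)
      (kerT (deriv (deriv (hartley c))) (fun t => t * (t * f t)) y) y := fun y =>
    (hasDerivAt_kerT hκ.deriv (hint _ (by fun_prop)) y).comp_ofReal
  have hF1' : deriv (fun y : ℝ => kerT (hartley c) f y) =
      fun y : ℝ => kerT (deriv (hartley c)) (fun t => t * f t) y := funext fun y => (hF1 y).deriv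
  have hdiff : Differentiable ℂ fun t : ℂ => hartley c (x * t) :=
    hκ.comp (differentiable_id.const_mul _)
  have hG1 : ∀ t : ℝ, HasDerivAt (fun t : ℝ => hartley c (x * t))
      (deriv (hartley c) (x * t) * x) t := fun t =>
    ((hκ (x * t)).hasDerivAt.comp (t : ℂ)
      (by simpa using (hasDerivAt_id (t : ℂ)).const_mul (x : ℂ))).comp_ofReal
  have hG2 : ∀ t : ℝ, HasDerivAt (fun t : ℝ => deriv (hartley c) (x * t) * x)
      (deriv (deriv (hartley c)) (x * t) * x * x) t := fun t =>
    (((hκ.deriv (x * t)).hasDerivAt.comp (t : ℂ)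
      (by simpa using (hasDerivAt_id (t : ℂ)).const_mul (x : ℂ))).mul_const (x : ℂ)).comp_ofReal
  have hG1' : deriv (fun t : ℝ => hartley c (x * t)) =
      fun t : ℝ => deriv (hartley c) (x * t) * x := funext fun t => (hG1 t).deriv
  -- By symmetry `T` moves onto the kernel in the variable `t`. Since the second derivative of
  -- `hartley c` is `-c²` times itself, applying `T` to `hartley c (x t)` in `t` or in `x` gives the
  -- same function.
  have h1 : kerT (hartley c) (heunExpr c f) x =
      ∫ t : ℝ, heunExpr c (fun t : ℝ => hartley c (x * t)) t * f t ∂muI :=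
    integral_mul_heunExpr_comm c hf (contDiff_comp_ofReal hdiff)
  have c0 : Continuous fun t : ℝ => hartley c (x * t) := by
    have := hκ.continuous; fun_prop
  have c1 : Continuous fun t : ℝ => deriv (hartley c) (x * t) := by
    have := hκ.deriv.continuous; fun_prop
  rw [h1, heunExpr, hF1', (hF2 x).deriv]
  simp only [kerT, deriv_deriv_hartley]
  rw [← integral_const_mul, ← integral_const_mul, ← integral_const_mul,
    ← integral_sub (hint _ (by fun_prop)) (hint _ (by fun_prop)),
    ← integral_sub (hint _ (by fun_prop)) (hint _ (by fun_prop))]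
  refine integral_congr_ae (Eventually.of_forall fun t => ?_)
  simp only
  rw [heunExpr, hG1', (hG2 t).deriv, deriv_deriv_hartley]
  ring

/-- The product is `cos(c(x-t)s) + sin(c(x+t)s)`, and the sine part is odd in `s`. The diagonal is
excluded because there the quotient on the right is `0` by convention. -/
theorem integral_hartley_mul_hartley {c : ℝ} (hc : c ≠ 0) {x t : ℝ} (hxt : x ≠ t) :
    ∫ s : ℝ, hartley c (s * t) * hartley c (x * s) ∂muI =
      (2 * Real.pi / c : ℝ) * ((Real.sin (c * (x - t)) / (Real.pi * (x - t)) : ℝ) : ℂ) := by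
  have hu : c * (x - t) ≠ 0 := mul_ne_zero hc (sub_ne_zero.2 hxt)
  have e : ∀ s : ℝ, hartley c (s * t) * hartley c (x * s) =
      ((Real.cos (c * (x - t) * s) + Real.sin (c * (x + t) * s) : ℝ) : ℂ) := fun s => by
    rw [show c * (x - t) * s = c * (x * s) - c * (s * t) by ring,
      show c * (x + t) * s = c * (x * s) + c * (s * t) by ring, Real.cos_sub, Real.sin_add,
      hartley, hartley]
    push_cast
    ring
  simp_rw [e]
  rw [integral_complex_ofReal, ← Complex.ofReal_mul, Complex.ofReal_inj]
  have hI : ∫ s, (Real.cos (c * (x - t) * s) + Real.sin (c * (x + t) * s)) ∂muI =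
      ∫ s in (-1 : ℝ)..1, (Real.cos (c * (x - t) * s) + Real.sin (c * (x + t) * s)) := by
    rw [intervalIntegral.integral_of_le (by norm_num), integral_Icc_eq_integral_Ioc]
  have hodd : ∫ s in (-1 : ℝ)..1, Real.sin (c * (x + t) * s) = 0 := by
    have := intervalIntegral.integral_comp_neg (a := -1) (b := 1)
      (fun s : ℝ => Real.sin (c * (x + t) * s))
    simp only [mul_neg, Real.sin_neg, intervalIntegral.integral_neg, neg_neg] at this
    linarith
  have hcos : ∫ s in (-1 : ℝ)..1, Real.cos (c * (x - t) * s) =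
      2 * Real.sin (c * (x - t)) / (c * (x - t)) := by
    rw [intervalIntegral.integral_comp_mul_left (fun s => Real.cos s) hu, integral_cos,
      mul_one, mul_neg_one, Real.sin_neg, smul_eq_mul]
    ring
  rw [hI, intervalIntegral.integral_add (Continuous.intervalIntegrable (by fun_prop) _ _)
    (Continuous.intervalIntegrable (by fun_prop) _ _), hodd, hcos]
  have := sub_ne_zero.2 hxt
  field_simp
  ring

/-- The square of the Hartley transform is a multiple of the time and band limiting operator. -/
theorem sincTransform_eq {c : ℝ} (hc : c ≠ 0) {φ : ℝ → ℂ} (hφ : Integrable φ muI) (x : ℝ) :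
    sincTransform c φ x =
      ((c / (2 * Real.pi) : ℝ) : ℂ) *
        kerT (hartley c) (fun s : ℝ => kerT (hartley c) φ s) x := by
  have hκ := (differentiable_hartley c).continuous
  have h := integral_mul_integral_comm (k := fun s t : ℝ => hartley c (s * t)) (φ := φ)
    (ψ := fun s : ℝ => hartley c (x * s)) (by fun_prop) hφ
    ((by fun_prop : Continuous fun s : ℝ => hartley c (x * s)).continuousOn.integrableOn_compact
      isCompact_Icc)
  have h' : kerT (hartley c) (fun s : ℝ => kerT (hartley c) φ s) x =
    ∫ t, φ t * ∫ s : ℝ, hartley c (s * t) * hartley c (x * s) ∂muI ∂muI := h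
  rw [h', sincTransform, ← integral_muI, ← integral_const_mul]
  refine integral_congr_ae ?_
  have hne : ∀ᵐ t ∂muI, t ≠ x := by
    refine ae_restrict_of_ae ?_
    simp [ae_iff]
  filter_upwards [hne] with t ht
  rw [integral_hartley_mul_hartley hc ht.symm, mul_left_comm, ← mul_assoc ((c / _ : ℝ) : ℂ),
    ← Complex.ofReal_mul, show c / (2 * Real.pi) * (2 * Real.pi / c) = 1 by
      have := Real.pi_ne_zero
      field_simp]
  rw [Complex.ofReal_one, one_mul, mul_comm]

/-! ### The orthonormal basis of joint eigenfunctions -/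

/-- The Hartley transform on `L²[-1, 1]`. -/
noncomputable def hartleyOp (c : ℝ) : L2I →L[ℂ] L2I := kerOp (hartley c) (differentiable_hartley c)

theorem isCompactOperator_hartleyOp (c : ℝ) : IsCompactOperator (hartleyOp c) :=
  isCompactOperator_kerOp _

theorem isSymmetric_hartleyOp (c : ℝ) : (hartleyOp c : L2I →ₗ[ℂ] L2I).IsSymmetric :=
  inner_kerOp _ (star_hartley c)

/-- `Ψ` is entire and a joint eigenfunction of the Heun operator (with eigenvalue `χ`) and of the
Hartley transform (with eigenvalue `h`). -/
def IsProlate (c χ h : ℝ) (Ψ : ℂ → ℂ) : Prop :=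
  IsHeunEigen c χ Ψ ∧ h ≠ 0 ∧ ∀ z, kerT (hartley c) (fun t : ℝ => Ψ t) z = h * Ψ z

theorem IsProlate.const_mul {c χ h : ℝ} {Ψ : ℂ → ℂ} (hΨ : IsProlate c χ h Ψ) (a : ℂ) :
    IsProlate c χ h (fun z => a * Ψ z) := by
  refine ⟨hΨ.1.const_mul a, hΨ.2.1, fun z => ?_⟩
  have e : kerT (hartley c) (fun t : ℝ => a * Ψ t) z =
      a * kerT (hartley c) (fun t : ℝ => Ψ t) z := by
    rw [kerT, kerT, ← integral_const_mul]
    simp_rw [mul_left_comm]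
  rw [e, hΨ.2.2]
  ring

theorem deriv_comp_ofReal_of_entire {Ψ : ℂ → ℂ} (h : Differentiable ℂ Ψ) :
    deriv (fun x : ℝ => Ψ x) = fun x : ℝ => deriv Ψ x :=
  funext fun x => (h x).hasDerivAt.comp_ofReal.deriv

theorem heunExpr_comp_ofReal (c : ℝ) {Ψ : ℂ → ℂ} (h : Differentiable ℂ Ψ) (x : ℝ) :
    heunExpr c (fun x : ℝ => Ψ x) x = (1 - (x : ℂ) ^ 2) * deriv (deriv Ψ) x
      - 2 * x * deriv Ψ x - (c : ℂ) ^ 2 * (x : ℂ) ^ 2 * Ψ x := by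
  rw [heunExpr, deriv_comp_ofReal_of_entire h, deriv_comp_ofReal_of_entire h.deriv]

theorem IsHeunEigen.heunT_eq {c χ : ℝ} {Ψ : ℂ → ℂ} (h : IsHeunEigen c χ Ψ) :
    heunT c (realRestrict Ψ h.1) = (χ : ℂ) • realRestrict Ψ h.1 :=
  Subtype.ext (funext fun x => (heunExpr_comp_ofReal c h.1 x).trans (h.2 x))

/-- An entire function satisfying the eigenvalue equation in `L²[-1, 1]` satisfies it on `ℂ`. -/
theorem isHeunEigen_of_smoothToL2 {c χ : ℝ} {Ψ : ℂ → ℂ} (hΨ : Differentiable ℂ Ψ)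
    (h : smoothToL2 (heunT c (realRestrict Ψ hΨ)) = (χ : ℂ) • smoothToL2 (realRestrict Ψ hΨ)) :
    IsHeunEigen c χ Ψ := by
  refine ⟨hΨ, fun z => sub_eq_zero.1 ?_⟩
  rw [← map_smul] at h
  have hI := eqOn_of_smoothToL2_eq h
  have d1 := hΨ.deriv
  have d2 := d1.deriv
  refine eq_zero_of_eqOn_Icc (F := fun z => (1 - z ^ 2) * deriv (deriv Ψ) z - 2 * z * deriv Ψ z
    - (c : ℂ) ^ 2 * z ^ 2 * Ψ z - χ * Ψ z) (by fun_prop) (fun x hx => ?_) z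
  have := hI hx
  exact sub_eq_zero.2 ((heunExpr_comp_ofReal c hΨ x).symm.trans this)

theorem IsHeunEigen.eigenvalue_nonpos {c χ : ℝ} {Ψ : ℂ → ℂ} (h : IsHeunEigen c χ Ψ)
    (h0 : smoothToL2 (realRestrict Ψ h.1) ≠ 0) : χ ≤ 0 := by
  have h1 := re_inner_heunT_nonpos c (realRestrict Ψ h.1)
  rw [h.heunT_eq, map_smul, inner_smul_right, inner_self_eq_norm_sq_to_K] at h1
  have h2 : 0 < ‖smoothToL2 (realRestrict Ψ h.1)‖ := norm_pos_iff.2 h0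
  have h3 : χ * ‖smoothToL2 (realRestrict Ψ h.1)‖ ^ 2 ≤ 0 := by
    simpa [← Complex.ofReal_pow] using h1
  by_contra hχ
  push Not at hχ
  have : 0 < χ * ‖smoothToL2 (realRestrict Ψ h.1)‖ ^ 2 := by positivity
  linarith

/-- The classes in `L²[-1, 1]` of the joint eigenfunctions. -/
def prolateSet (c : ℝ) : Set L2I :=
  {v | ∃ (χ h : ℝ) (Ψ : ℂ → ℂ) (hΨ : IsProlate c χ h Ψ), smoothToL2 (realRestrict Ψ hΨ.1.1) = v}

section Eigenspace

variable {c μ : ℝ} {φ : L2I}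

/-- An eigenvector equals `μ⁻¹` times its own transform, so it has an entire representative on which
`T` can act. -/
theorem smoothToL2_of_hartleyOp_eigen (hμ : μ ≠ 0) (hφ : hartleyOp c φ = (μ : ℂ) • φ) :
    smoothToL2 ((μ : ℂ)⁻¹ • kerSmooth (hartley c) (differentiable_hartley c) φ) = φ := by
  rw [map_smul, ← kerOp_apply, ← hartleyOp, hφ, smul_smul,
    inv_mul_cancel₀ (Complex.ofReal_ne_zero.2 hμ), one_smul]

theorem kerT_of_hartleyOp_eigen (hμ : μ ≠ 0) (hφ : hartleyOp c φ = (μ : ℂ) • φ) (z : ℂ) :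
    kerT (hartley c) (fun t : ℝ => (μ : ℂ)⁻¹ * kerT (hartley c) φ t) z =
      μ * ((μ : ℂ)⁻¹ * kerT (hartley c) φ z) := by
  rw [mul_inv_cancel_left₀ (Complex.ofReal_ne_zero.2 hμ)]
  refine kerT_congr _ ?_ z
  have h := coeFn_smoothToL2 ((μ : ℂ)⁻¹ • kerSmooth (hartley c) (differentiable_hartley c) φ)
  rw [smoothToL2_of_hartleyOp_eigen hμ hφ] at h
  exact h.symm

theorem hartleyOp_heunT_eigen (hμ : μ ≠ 0) (hφ : hartleyOp c φ = (μ : ℂ) • φ) :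
    hartleyOp c (smoothToL2 (heunT c ((μ : ℂ)⁻¹ •
      kerSmooth (hartley c) (differentiable_hartley c) φ))) =
      (μ : ℂ) • smoothToL2 (heunT c ((μ : ℂ)⁻¹ •
        kerSmooth (hartley c) (differentiable_hartley c) φ)) := by
  set f : SmoothFun := (μ : ℂ)⁻¹ • kerSmooth (hartley c) (differentiable_hartley c) φ with hf
  rw [hartleyOp, kerOp_apply, ← map_smul, ← map_smul]
  refine congrArg _ (Subtype.ext (funext fun x => ?_))
  rw [kerSmooth_apply, kerT_congr _ (coeFn_smoothToL2 (heunT c f))]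
  have h1 := kerT_hartley_heunExpr c (smoothFun_contDiff f) x
  have h2 : (fun y : ℝ => kerT (hartley c) (f : ℝ → ℂ) y) = ((μ : ℂ) • f : SmoothFun) :=
    funext fun y => kerT_of_hartleyOp_eigen hμ hφ y
  rw [h2] at h1
  exact h1

/-- By compactness the eigenspace is finite-dimensional. `T` preserves it, since it commutes with
the transform, and is symmetric on it, so finite-dimensional diagonalisation applies. -/
theorem mem_span_prolateSet_of_eigen (hμ : μ ≠ 0) (hφ : hartleyOp c φ = (μ : ℂ) • φ) :
    φ ∈ Submodule.span ℂ (prolateSet c) := by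
  have hμ' : (μ : ℂ) ≠ 0 := Complex.ofReal_ne_zero.2 hμ
  set E := Module.End.eigenspace (hartleyOp c : L2I →ₗ[ℂ] L2I) (μ : ℂ) with hE
  have : FiniteDimensional ℂ E :=
    ContinuousLinearMap.finite_dimensional_eigenspace (isCompactOperator_hartleyOp c) _ hμ'
  have hmem : ∀ {ψ : L2I}, ψ ∈ E ↔ hartleyOp c ψ = (μ : ℂ) • ψ := Module.End.mem_eigenspace_iff
  -- `S` picks the entire representative, turning `T` into an endomorphism `A` of the eigenspace.
  let S : L2I →ₗ[ℂ] SmoothFun := (μ : ℂ)⁻¹ • kerSmooth (hartley c) (differentiable_hartley c)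
  have hS : ∀ ψ ∈ E, smoothToL2 (S ψ) = ψ := fun ψ hψ =>
    smoothToL2_of_hartleyOp_eigen hμ (hmem.1 hψ)
  let A : E →ₗ[ℂ] E := (smoothToL2 ∘ₗ heunT c ∘ₗ S).restrict
    fun ψ hψ => hmem.2 (hartleyOp_heunT_eigen hμ (hmem.1 hψ))
  have hA : ∀ ψ : E, ((A ψ : E) : L2I) = smoothToL2 (heunT c (S ψ)) := fun ψ => rfl
  have hsym : A.IsSymmetric := fun ψ η => by
    rw [Submodule.coe_inner, Submodule.coe_inner, hA, hA]
    conv_lhs => rw [← hS η η.2]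
    conv_rhs => rw [← hS ψ ψ.2]
    exact inner_heunT c _ _
  have htop : ⨆ ν, Module.End.eigenspace A ν = ⊤ :=
    Submodule.orthogonal_eq_bot_iff.1 hsym.orthogonalComplement_iSup_eigenspaces_eq_bot
  have hle : ⨆ ν, Module.End.eigenspace A ν ≤
      (Submodule.span ℂ (prolateSet c)).comap E.subtype := by
    refine iSup_le fun ν v hv => ?_
    by_cases hv0 : v = 0
    · rw [hv0]
      exact Submodule.zero_mem _
    have hν : ((ν.re : ℝ) : ℂ) = ν := Complex.conj_eq_iff_re.1
      (hsym.conj_eigenvalue_eq_self (Module.End.hasEigenvalue_of_hasEigenvector ⟨hv, hv0⟩))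
    have hv1 : smoothToL2 (heunT c (S v)) = ν • (v : L2I) := by
      rw [← hA, Module.End.mem_eigenspace_iff.1 hv]
      rfl
    have hd : Differentiable ℂ fun z => (μ : ℂ)⁻¹ * kerT (hartley c) v z :=
      (differentiable_kerT (differentiable_hartley c) (integrable_L2I v)).const_mul _
    have hr : realRestrict _ hd = S v := rfl
    have hpr : IsProlate c ν.re μ fun z => (μ : ℂ)⁻¹ * kerT (hartley c) v z := by
      refine ⟨isHeunEigen_of_smoothToL2 hd ?_, hμ, kerT_of_hartleyOp_eigen hμ (hmem.1 v.2)⟩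
      rw [hr, hv1, hν, hS v v.2]
    exact Submodule.subset_span ⟨ν.re, μ, _, hpr, hS v v.2⟩
  exact hle (htop ▸ Submodule.mem_top : (⟨φ, hmem.2 hφ⟩ : E) ∈ _)

end Eigenspace

/-- The spectral theorem for compact symmetric operators makes the eigenspaces total; injectivity
rules out the eigenvalue `0`. -/
theorem span_prolateSet_orthogonal {c : ℝ} (hc : c ≠ 0) :
    (Submodule.span ℂ (prolateSet c))ᗮ = ⊥ := by
  have h := ContinuousLinearMap.orthogonalComplement_iSup_eigenspaces_eq_bot
    (isCompactOperator_hartleyOp c) (isSymmetric_hartleyOp c)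
  rw [eq_bot_iff, ← h]
  refine Submodule.orthogonal_le (iSup_le fun μ v hv => ?_)
  by_cases hv0 : v = 0
  · rw [hv0]
    exact Submodule.zero_mem _
  have hμ : ((μ.re : ℝ) : ℂ) = μ := Complex.conj_eq_iff_re.1
    ((isSymmetric_hartleyOp c).conj_eigenvalue_eq_self
      (Module.End.hasEigenvalue_of_hasEigenvector ⟨hv, hv0⟩))
  have hv1 : hartleyOp c v = ((μ.re : ℝ) : ℂ) • v := by
    rw [hμ]
    exact Module.End.mem_eigenspace_iff.1 hv
  refine mem_span_prolateSet_of_eigen (fun h0 => hv0 ?_) hv1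
  rw [h0, Complex.ofReal_zero, zero_smul] at hv1
  exact kerOp_hartley_injective hc hv1

theorem IsHeunEigen.inner_eq_zero {c χ χ' : ℝ} {Ψ Ψ' : ℂ → ℂ} (h : IsHeunEigen c χ Ψ)
    (h' : IsHeunEigen c χ' Ψ') (hne : χ ≠ χ') :
    inner ℂ (smoothToL2 (realRestrict Ψ h.1)) (smoothToL2 (realRestrict Ψ' h'.1)) = 0 := by
  have e := inner_heunT c (realRestrict Ψ h.1) (realRestrict Ψ' h'.1)
  rw [h.heunT_eq, h'.heunT_eq, map_smul, map_smul, inner_smul_left, inner_smul_right,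
    Complex.conj_ofReal, ← sub_eq_zero, ← sub_mul] at e
  exact (mul_eq_zero.1 e).resolve_left (sub_ne_zero.2 fun hh => hne (Complex.ofReal_inj.1 hh))

theorem smoothToL2_ne_zero_iff {Ψ : ℂ → ℂ} {c χ : ℝ} (h : IsHeunEigen c χ Ψ) :
    smoothToL2 (realRestrict Ψ h.1) ≠ 0 ↔ Ψ 1 ≠ 0 := by
  refine not_congr ⟨fun h0 => ?_, fun h1 => ?_⟩
  · rw [← map_zero smoothToL2] at h0
    have := eqOn_of_smoothToL2_eq h0 (x := 1) (by simp)
    simpa [realRestrict] using this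
  · have h0 : realRestrict Ψ h.1 = 0 := Subtype.ext (funext fun x => h.eq_zero h1 x)
    rw [h0, map_zero]

theorem exists_prolate_hilbertBasis {c : ℝ} (hc : c ≠ 0) :
    ∃ (ι : Type) (b : HilbertBasis ι ℂ L2I) (χ h : ι → ℝ) (Ψ : ι → ℂ → ℂ)
      (hΨ : ∀ i, IsProlate c (χ i) (h i) (Ψ i)),
      ∀ i, χ i ≤ 0 ∧ Ψ i 1 ≠ 0 ∧ b i = smoothToL2 (realRestrict (Ψ i) (hΨ i).1.1) := by
  -- The eigenvalues of `T` themselves index the basis: distinct ones give orthogonal functions, and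
  -- each has a one-dimensional space of entire solutions.
  let X : Set ℝ := {χ | ∃ (h : ℝ) (Ψ : ℂ → ℂ) (hΨ : IsProlate c χ h Ψ),
    ‖smoothToL2 (realRestrict Ψ hΨ.1.1)‖ = 1}
  choose h Ψ hΨ hn using fun χ : X => χ.2
  have hnz : ∀ i, smoothToL2 (realRestrict (Ψ i) (hΨ i).1.1) ≠ 0 := fun i h0 => by
    have := hn i
    rw [h0, norm_zero] at this
    exact zero_ne_one this
  have hon : Orthonormal ℂ fun i => smoothToL2 (realRestrict (Ψ i) (hΨ i).1.1) :=
    ⟨hn, fun i j hij => (hΨ i).1.inner_eq_zero (hΨ j).1 fun h => hij (Subtype.ext h)⟩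
  have hsp : prolateSet c ⊆ Submodule.span ℂ
      (Set.range fun i => smoothToL2 (realRestrict (Ψ i) (hΨ i).1.1)) := by
    rintro v ⟨χ, k, Φ, hΦ, rfl⟩
    by_cases h0 : smoothToL2 (realRestrict Φ hΦ.1.1) = 0
    · rw [h0]
      exact Submodule.zero_mem _
    have hX : χ ∈ X := by
      refine ⟨k, _, hΦ.const_mul ((‖smoothToL2 (realRestrict Φ hΦ.1.1)‖⁻¹ : ℝ) : ℂ), ?_⟩
      have e : realRestrict _ (hΦ.const_mul
          ((‖smoothToL2 (realRestrict Φ hΦ.1.1)‖⁻¹ : ℝ) : ℂ)).1.1 =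
          ((‖smoothToL2 (realRestrict Φ hΦ.1.1)‖⁻¹ : ℝ) : ℂ) • realRestrict Φ hΦ.1.1 := rfl
      rw [e, map_smul, norm_smul, Complex.norm_real, norm_inv, norm_norm,
        inv_mul_cancel₀ (norm_ne_zero_iff.2 h0)]
    have h1 := (smoothToL2_ne_zero_iff (hΨ ⟨χ, hX⟩).1).1 (hnz ⟨χ, hX⟩)
    have e : realRestrict Φ hΦ.1.1 =
        (Φ 1 / Ψ ⟨χ, hX⟩ 1) • realRestrict (Ψ ⟨χ, hX⟩) (hΨ ⟨χ, hX⟩).1.1 := by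
      refine Subtype.ext (funext fun x => ?_)
      have hz := (hΦ.1.add ((hΨ ⟨χ, hX⟩).1.const_mul (-(Φ 1 / Ψ ⟨χ, hX⟩ 1)))).eq_zero
        (by field_simp; ring) x
      change Φ x = Φ 1 / Ψ ⟨χ, hX⟩ 1 * Ψ ⟨χ, hX⟩ x
      linear_combination hz
    rw [e, map_smul]
    exact Submodule.smul_mem _ _ (Submodule.subset_span ⟨_, rfl⟩)
  have hbot : (Submodule.span ℂ
      (Set.range fun i => smoothToL2 (realRestrict (Ψ i) (hΨ i).1.1)))ᗮ = ⊥ := by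
    rw [eq_bot_iff, ← span_prolateSet_orthogonal hc]
    exact Submodule.orthogonal_le (Submodule.span_le.2 hsp)
  refine ⟨X, HilbertBasis.mkOfOrthogonalEqBot hon hbot, fun i => i, h, Ψ, hΨ, fun i =>
    ⟨(hΨ i).1.eigenvalue_nonpos (hnz i), (smoothToL2_ne_zero_iff (hΨ i).1).1 (hnz i), ?_⟩⟩
  rw [HilbertBasis.coe_mkOfOrthogonalEqBot]

/-! ### Diagonal operators -/

section Diagonal

variable {ι E : Type*} [NormedAddCommGroup E] [InnerProductSpace ℂ E]

theorem hilbertBasis_ext_inner (b : HilbertBasis ι ℂ E) {x y : E}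
    (h : ∀ i, inner ℂ (b i) x = inner ℂ (b i) y) : x = y := by
  refine b.repr.injective (lp.ext (funext fun i => ?_))
  rw [b.repr_apply_apply, b.repr_apply_apply, h]

theorem exists_diagonal_operator (b : HilbertBasis ι ℂ E) {m : ι → ℂ} {C : ℝ} (hC : 0 ≤ C)
    (hm : ∀ i, ‖m i‖ ≤ C) :
    ∃ T : E →L[ℂ] E, (∀ φ i, inner ℂ (b i) (T φ) = m i * inner ℂ (b i) φ) ∧
      ∀ φ, ‖T φ‖ ≤ C * ‖φ‖ := by
  have hle : ∀ (f : lp (fun _ : ι => ℂ) 2) (i : ι), ‖m i * f i‖ ≤ ‖((C : ℂ) • f) i‖ := fun f i => by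
    rw [lp.coeFn_smul, Pi.smul_apply, norm_mul, norm_smul, Complex.norm_real, Real.norm_eq_abs,
      abs_of_nonneg hC]
    exact mul_le_mul_of_nonneg_right (hm i) (norm_nonneg _)
  have hmem : ∀ f : lp (fun _ : ι => ℂ) 2, Memℓp (fun i => m i * f i) 2 := fun f =>
    (lp.memℓp ((C : ℂ) • f)).mono' (hle f)
  let D : lp (fun _ : ι => ℂ) 2 →ₗ[ℂ] lp (fun _ : ι => ℂ) 2 :=
    { toFun := fun f => ⟨fun i => m i * f i, hmem f⟩
      map_add' := fun f g => lp.ext (funext fun i => mul_add _ _ _)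
      map_smul' := fun a f => lp.ext (funext fun i => mul_left_comm _ _ _) }
  have hD : ∀ f, ‖D f‖ ≤ C * ‖f‖ := fun f => by
    have h : ‖D f‖ ≤ ‖(C : ℂ) • f‖ := lp.norm_mono two_ne_zero (hle f)
    rwa [norm_smul, Complex.norm_real, Real.norm_eq_abs, abs_of_nonneg hC] at h
  let T : E →ₗ[ℂ] E := b.repr.symm.toLinearEquiv.toLinearMap ∘ₗ D ∘ₗ b.repr.toLinearEquiv.toLinearMap
  have hT : ∀ φ, T φ = b.repr.symm (D (b.repr φ)) := fun φ => rfl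
  have hbound : ∀ φ, ‖T φ‖ ≤ C * ‖φ‖ := fun φ => by
    rw [hT, LinearIsometryEquiv.norm_map, ← b.repr.norm_map φ]
    exact hD _
  refine ⟨T.mkContinuous C hbound, fun φ i => ?_, hbound⟩
  rw [LinearMap.mkContinuous_apply, hT, ← b.repr_apply_apply, LinearIsometryEquiv.apply_symm_apply,
    ← b.repr_apply_apply]
  rfl

/-- Strong continuity extends from the basis to its span by linearity, then to the closure because
the uniform bound turns approximation of `φ` into uniform approximation in `x`. -/
theorem continuous_apply_of_hilbertBasis {X : Type*} [TopologicalSpace X] (b : HilbertBasis ι ℂ E)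
    {U : X → E →L[ℂ] E} {C : ℝ} (hU : ∀ x φ, ‖U x φ‖ ≤ C * ‖φ‖)
    (hb : ∀ i, Continuous fun x => U x (b i)) (φ : E) : Continuous fun x => U x φ := by
  let S : Submodule ℂ E :=
    { carrier := {φ | Continuous fun x => U x φ}
      add_mem' := fun {φ ψ} hφ hψ => by
        simp only [Set.mem_ofPred_eq, map_add] at *
        exact hφ.add hψ
      zero_mem' := by simpa using continuous_const
      smul_mem' := fun a φ hφ => by
        simp only [Set.mem_ofPred_eq, map_smul] at *
        exact hφ.const_smul a }
  have hle : Submodule.span ℂ (Set.range b) ≤ S := Submodule.span_le.2 (by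
    rintro _ ⟨i, rfl⟩
    exact hb i)
  have hφ : φ ∈ closure (Submodule.span ℂ (Set.range b) : Set E) := by
    rw [← Submodule.topologicalClosure_coe, b.dense_span]
    trivial
  refine continuous_of_uniform_approx_of_continuous fun u hu => ?_
  obtain ⟨ε, hε, hu⟩ := Metric.mem_uniformity_dist.1 hu
  obtain ⟨ψ, hψ, hd⟩ := Metric.mem_closure_iff.1 hφ (ε / (|C| + 1)) (by positivity)
  refine ⟨fun x => U x ψ, hle hψ, fun x => hu ?_⟩
  rw [dist_eq_norm, ← map_sub]
  rw [dist_eq_norm, lt_div_iff₀ (by positivity)] at hd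
  calc ‖U x (φ - ψ)‖ ≤ C * ‖φ - ψ‖ := hU _ _
    _ ≤ (|C| + 1) * ‖φ - ψ‖ := by
        gcongr
        linarith [le_abs_self C]
    _ < ε := by rwa [mul_comm]

end Diagonal

/-! ### The operators `U (ξ; T)` -/

/-- Symmetry moves the powers of `T` onto the eigenfunction, so arbitrary smooth `f` is allowed
although `T` is unbounded. -/
theorem IsHeunEigen.inner_aeval {c χ : ℝ} {Ψ : ℂ → ℂ} (h : IsHeunEigen c χ Ψ)
    (p : Polynomial ℂ) (f : SmoothFun) :
    inner ℂ (smoothToL2 (realRestrict Ψ h.1)) (smoothToL2 (Polynomial.aeval (heunT c) p f)) =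
      p.eval (χ : ℂ) * inner ℂ (smoothToL2 (realRestrict Ψ h.1)) (smoothToL2 f) := by
  have hpow : ∀ n : ℕ, inner ℂ (smoothToL2 (realRestrict Ψ h.1))
      (smoothToL2 ((heunT c ^ n) f)) =
      (χ : ℂ) ^ n * inner ℂ (smoothToL2 (realRestrict Ψ h.1)) (smoothToL2 f) := fun n => by
    induction n with
    | zero => simp
    | succ n ih =>
      rw [pow_succ' (heunT c), Module.End.mul_apply, ← inner_heunT, h.heunT_eq, map_smul, inner_smul_left,
        Complex.conj_ofReal, ih]
      ring
  induction p using Polynomial.induction_on' with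
  | add p q hp hq =>
    rw [map_add, LinearMap.add_apply, map_add, inner_add_right, hp, hq, Polynomial.eval_add]
    ring
  | monomial n a =>
    rw [Polynomial.aeval_monomial, Module.End.mul_apply, Module.algebraMap_end_apply, map_smul,
      inner_smul_right, hpow, Polynomial.eval_monomial]
    ring

theorem IsHeunEigen.tendsto_sum {c χ : ℝ} {Ψ : ℂ → ℂ} (h : IsHeunEigen c χ Ψ) (h1 : Ψ 1 ≠ 0)
    (ξ : ℝ) :
    Tendsto (fun n => ∑ k ∈ Finset.range n,
      (ξ : ℂ) ^ k / (k.factorial : ℂ) * (polyU c k).eval (χ : ℂ)) atTop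
      (𝓝 (Ψ (1 - ξ) / Ψ 1)) := by
  have := ((h.hasSum ξ).div_const (Ψ 1)).tendsto_sum_nat
  simpa only [mul_div_cancel_right₀ _ h1] using this

theorem IsHeunEigen.inner_partialU {c χ : ℝ} {Ψ : ℂ → ℂ} (h : IsHeunEigen c χ Ψ) (ξ : ℝ) (n : ℕ)
    (f : SmoothFun) :
    inner ℂ (smoothToL2 (realRestrict Ψ h.1)) (partialU c ξ n f) =
      (∑ k ∈ Finset.range n, (ξ : ℂ) ^ k / (k.factorial : ℂ) * (polyU c k).eval (χ : ℂ)) *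
        inner ℂ (smoothToL2 (realRestrict Ψ h.1)) (smoothToL2 f) := by
  rw [partialU, LinearMap.sum_apply, inner_sum, Finset.sum_mul]
  refine Finset.sum_congr rfl fun k _ => ?_
  rw [LinearMap.smul_apply, LinearMap.comp_apply, inner_smul_right, h.inner_aeval, mul_assoc]

theorem IsHeunEigen.partialU_eq {c χ : ℝ} {Ψ : ℂ → ℂ} (h : IsHeunEigen c χ Ψ) (ξ : ℝ) (n : ℕ) :
    partialU c ξ n (realRestrict Ψ h.1) =
      (∑ k ∈ Finset.range n, (ξ : ℂ) ^ k / (k.factorial : ℂ) * (polyU c k).eval (χ : ℂ)) •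
        smoothToL2 (realRestrict Ψ h.1) := by
  rw [partialU, LinearMap.sum_apply, Finset.sum_smul]
  refine Finset.sum_congr rfl fun k _ => ?_
  rw [LinearMap.smul_apply, LinearMap.comp_apply,
    Module.End.aeval_apply_of_mem_apply_eq_smul h.heunT_eq,
    map_smul, smul_smul]

/-- The basis vectors lie in the domain of the series and have dense span, so the closure contains
the graph of the bounded `U`. Conversely, testing a convergent series against each `b i` forces its
sum to be `U φ`, and the graph of `U` is closed. -/
theorem graph_eq_graphU {c ξ : ℝ} {ι : Type} (b : HilbertBasis ι ℂ L2I) {χ : ι → ℝ}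
    {Ψ : ι → ℂ → ℂ} (hΨ : ∀ i, IsHeunEigen c (χ i) (Ψ i)) (h1 : ∀ i, Ψ i 1 ≠ 0)
    (hb : ∀ i, b i = smoothToL2 (realRestrict (Ψ i) (hΨ i).1)) {U : L2I →L[ℂ] L2I}
    (hU : ∀ φ i, inner ℂ (b i) (U φ) = Ψ i (1 - ξ) / Ψ i 1 * inner ℂ (b i) φ) :
    LinearMap.graph (U : L2I →ₗ[ℂ] L2I) = graphU c ξ := by
  have hclosed : IsClosed (LinearMap.graph (U : L2I →ₗ[ℂ] L2I) : Set (L2I × L2I)) := by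
    have : (LinearMap.graph (U : L2I →ₗ[ℂ] L2I) : Set (L2I × L2I)) = {p | p.2 = U p.1} := by
      ext p
      exact LinearMap.mem_graph_iff _ p
    rw [this]
    exact isClosed_eq continuous_snd (U.continuous.comp continuous_fst)
  refine le_antisymm ?_ (Submodule.topologicalClosure_minimal _ ?_ hclosed)
  · have hUb : ∀ i, U (b i) = (Ψ i (1 - ξ) / Ψ i 1) • b i := fun i => by
      refine hilbertBasis_ext_inner b fun j => ?_
      rw [hU, inner_smul_right]
      by_cases hij : j = i
      · rw [hij]
      · rw [b.orthonormal.2 hij, mul_zero, mul_zero]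
    let G : L2I →L[ℂ] L2I × L2I := (ContinuousLinearMap.id ℂ L2I).prod U
    have hspan : Submodule.span ℂ (Set.range b) ≤ (graphU c ξ).comap (G : L2I →ₗ[ℂ] L2I × L2I) := by
      refine Submodule.span_le.2 ?_
      rintro _ ⟨i, rfl⟩
      refine Submodule.le_topologicalClosure _ ⟨realRestrict (Ψ i) (hΨ i).1, (hb i).symm, ?_⟩
      change Tendsto _ _ (𝓝 (U (b i)))
      simp_rw [(hΨ i).partialU_eq]
      rw [hUb, ← hb]
      exact ((hΨ i).tendsto_sum (h1 i) ξ).smul_const _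
    have hcl := Submodule.topologicalClosure_minimal _ hspan
      ((Submodule.isClosed_topologicalClosure _).preimage G.continuous)
    rw [b.dense_span] at hcl
    rintro ⟨φ, ψ⟩ hp
    rw [LinearMap.mem_graph_iff] at hp
    have := hcl (Submodule.mem_top (x := φ))
    change ψ = U φ at hp
    rw [hp]
    exact this
  · rintro ⟨φ, ψ⟩ ⟨f, hf, hlim⟩
    rw [LinearMap.mem_graph_iff]
    refine hilbertBasis_ext_inner b fun i => ?_
    have e1 := (tendsto_const_nhds (x := b i)).inner (𝕜 := ℂ) hlim
    have e2 : Tendsto (fun n => inner ℂ (b i) (partialU c ξ n f)) atTop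
        (𝓝 (Ψ i (1 - ξ) / Ψ i 1 * inner ℂ (b i) φ)) := by
      simp_rw [hb i, (hΨ i).inner_partialU, hf]
      exact ((hΨ i).tendsto_sum (h1 i) ξ).mul_const _
    exact (tendsto_nhds_unique e1 e2).trans (hU φ i).symm

/-! ### The time and band limiting operator -/

theorem opQ_eq {c : ℝ} (hc : c ≠ 0) (φ : L2I) :
    opQ c φ = ((c / (2 * Real.pi) : ℝ) : ℂ) • hartleyOp c (hartleyOp c φ) := by
  rw [hartleyOp, kerOp_apply, ← map_smul]
  refine MemLp.toLp_congr (sincTransform_memLp c φ) (smooth_memLp _)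
    (Eventually.of_forall fun x => ?_)
  rw [sincTransform_eq hc (integrable_L2I φ), Submodule.coe_smul, Pi.smul_apply, kerSmooth_apply,
    kerOp_apply,
    kerT_congr _ (coeFn_smoothToL2 (kerSmooth (hartley c) (differentiable_hartley c) φ)),
    smul_eq_mul]
  rfl

theorem IsProlate.hartleyOp_eq {c χ h : ℝ} {Ψ : ℂ → ℂ} (hΨ : IsProlate c χ h Ψ) :
    hartleyOp c (smoothToL2 (realRestrict Ψ hΨ.1.1)) =
      (h : ℂ) • smoothToL2 (realRestrict Ψ hΨ.1.1) := by
  rw [hartleyOp, kerOp_apply, ← map_smul]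
  refine congrArg _ (Subtype.ext (funext fun x => ?_))
  rw [kerSmooth_apply, kerT_congr _ (coeFn_smoothToL2 _)]
  exact hΨ.2.2 x

theorem IsProlate.inner_opQ {c χ h : ℝ} (hc : c ≠ 0) {Ψ : ℂ → ℂ} (hΨ : IsProlate c χ h Ψ)
    (φ : L2I) :
    inner ℂ (smoothToL2 (realRestrict Ψ hΨ.1.1)) (opQ c φ) =
      ((c / (2 * Real.pi) : ℝ) : ℂ) * (h : ℂ) ^ 2 *
        inner ℂ (smoothToL2 (realRestrict Ψ hΨ.1.1)) φ := by
  have hs : ∀ ψ η : L2I, inner ℂ ψ (hartleyOp c η) = inner ℂ (hartleyOp c ψ) η := fun ψ η =>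
    (isSymmetric_hartleyOp c ψ η).symm
  rw [opQ_eq hc, inner_smul_right, hs, hΨ.hartleyOp_eq, inner_smul_left, hs, hΨ.hartleyOp_eq,
    inner_smul_left, Complex.conj_ofReal]
  ring

/-- This is the identity `Q_c Ψ = (c/2π) h² Ψ` read at the endpoint `x = 1`, after the substitution
`t = 1 - ξ`. -/
theorem IsProlate.integral_sinc {c χ h : ℝ} (hc : c ≠ 0) {Ψ : ℂ → ℂ} (hΨ : IsProlate c χ h Ψ) :
    ∫ ξ in (0 : ℝ)..2, ((Real.sin (c * ξ) / (Real.pi * ξ) : ℝ) : ℂ) * Ψ (1 - ξ) =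
      ((c / (2 * Real.pi) : ℝ) : ℂ) * (h : ℂ) ^ 2 * Ψ 1 := by
  have hcont : Continuous fun t : ℝ => Ψ t := hΨ.1.1.continuous.comp Complex.continuous_ofReal
  have h1 := sincTransform_eq hc (φ := fun t : ℝ => Ψ t)
    (hcont.continuousOn.integrableOn_compact isCompact_Icc) 1
  have h2 : kerT (hartley c) (fun s : ℝ => kerT (hartley c) (fun t : ℝ => Ψ t) s) (1 : ℝ) =
      h * (h * Ψ 1) := by
    have := hΨ.2.2 1
    simp_rw [hΨ.2.2]
    rw [← this, kerT, kerT, ← integral_const_mul, Complex.ofReal_one]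
    simp_rw [mul_left_comm]
  have h3 := intervalIntegral.integral_comp_sub_left (a := 0) (b := 2)
    (fun t : ℝ => ((Real.sin (c * (1 - t)) / (Real.pi * (1 - t)) : ℝ) : ℂ) * Ψ t) 1
  simp only [sub_sub_cancel, sub_zero, Complex.ofReal_sub, Complex.ofReal_one] at h3
  rw [h3, show (1 - 2 : ℝ) = -1 by norm_num]
  rw [h2] at h1
  rw [sincTransform] at h1
  rw [h1]
  ring

theorem intervalIntegrable_sinc_smul (c : ℝ) {F : ℝ → L2I} (hF : Continuous F) :
    IntervalIntegrable (fun ξ : ℝ => ((Real.sin (c * ξ) / (Real.pi * ξ) : ℝ) : ℂ) • F ξ)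
      volume 0 2 := by
  have hm : Measurable fun ξ : ℝ => ((Real.sin (c * ξ) / (Real.pi * ξ) : ℝ) : ℂ) := by fun_prop
  refine ((hF.norm.intervalIntegrable 0 2).const_mul (|c| / Real.pi)).mono_fun'
    (hm.aestronglyMeasurable.smul hF.aestronglyMeasurable) (Eventually.of_forall fun ξ => ?_)
  simp only
  rw [norm_smul]
  exact mul_le_mul_of_nonneg_right (sincKernel_bound c ξ) (norm_nonneg _)

theorem mainTheorem2 (c : ℝ) (hc : 0 < c) :
    ∃ U : ℝ → (L2I →L[ℂ] L2I),
      (∀ ξ ∈ Set.Ico (0 : ℝ) 2, LinearMap.graph (U ξ : L2I →ₗ[ℂ] L2I) = graphU c ξ) ∧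
      ∀ φ : L2I,
        IntervalIntegrable
          (fun ξ : ℝ => ((Real.sin (c * ξ) / (Real.pi * ξ) : ℝ) : ℂ) • U ξ φ) volume 0 2 ∧
        opQ c φ = ∫ ξ in (0 : ℝ)..2, ((Real.sin (c * ξ) / (Real.pi * ξ) : ℝ) : ℂ) • U ξ φ := by
  obtain ⟨ι, b, χ, h, Ψ, hΨ, hb⟩ := exists_prolate_hilbertBasis hc.ne'
  -- Clamping `ξ` to `[0, 2]` keeps `1 - r ξ` in `[-1, 1]`, where the uniform bound holds, and makes
  -- `ξ ↦ U ξ φ` continuous on the whole line.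
  let r : ℝ → ℝ := fun ξ => max 0 (min ξ 2)
  have hr : ∀ ξ, r ξ ∈ Set.Icc (0 : ℝ) 2 := fun ξ =>
    ⟨le_max_left _ _, max_le (by norm_num) (min_le_right _ _)⟩
  have hr' : ∀ ξ ∈ Set.Icc (0 : ℝ) 2, r ξ = ξ := fun ξ hξ => by
    simp only [r, min_eq_left hξ.2, max_eq_right hξ.1]
  have hrc : Continuous r := by fun_prop
  have hm : ∀ ξ i, ‖Ψ i (1 - r ξ) / Ψ i 1‖ ≤ heunBound c := fun ξ i => by
    rw [norm_div, div_le_iff₀ (norm_pos_iff.2 (hb i).2.1)]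
    have := (hΨ i).1.norm_le (hb i).1 (y := 1 - r ξ)
      ⟨by linarith [(hr ξ).2], by linarith [(hr ξ).1]⟩
    rwa [Complex.ofReal_sub, Complex.ofReal_one] at this
  choose U hU hUn using fun ξ => exists_diagonal_operator b (Real.exp_pos _).le (hm ξ)
  have hUb : ∀ ξ i, U ξ (b i) = (Ψ i (1 - r ξ) / Ψ i 1) • b i := fun ξ i => by
    refine hilbertBasis_ext_inner b fun j => ?_
    rw [hU, inner_smul_right]
    by_cases hij : j = i
    · rw [hij]
    · rw [b.orthonormal.2 hij, mul_zero, mul_zero]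
  have hcont : ∀ φ, Continuous fun ξ => U ξ φ := by
    refine continuous_apply_of_hilbertBasis b hUn fun i => ?_
    simp_rw [hUb]
    have := (hΨ i).1.1.continuous
    fun_prop
  refine ⟨U, fun ξ hξ => ?_, fun φ => ?_⟩
  · refine graph_eq_graphU b (fun i => (hΨ i).1) (fun i => (hb i).2.1) (fun i => (hb i).2.2)
      fun φ i => ?_
    rw [hU, hr' ξ ⟨hξ.1, hξ.2.le⟩]
  · have hint := intervalIntegrable_sinc_smul c (hcont φ)
    -- It suffices to compare coefficients: the inner product with `b i` passes through the integral
    -- and leaves a scalar integral of `Ψ i (1 - ξ)`.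
    refine ⟨hint, hilbertBasis_ext_inner b fun i => ?_⟩
    have hcomm := (innerSL ℂ (b i)).intervalIntegral_comp_comm hint
    simp only [innerSL_apply_apply] at hcomm
    rw [← hcomm]
    simp_rw [inner_smul_right, hU]
    have e : ∫ ξ in (0 : ℝ)..2, ((Real.sin (c * ξ) / (Real.pi * ξ) : ℝ) : ℂ) *
        (Ψ i (1 - r ξ) / Ψ i 1 * inner ℂ (b i) φ) =
        ∫ ξ in (0 : ℝ)..2, (((Real.sin (c * ξ) / (Real.pi * ξ) : ℝ) : ℂ) * Ψ i (1 - ξ)) *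
          (inner ℂ (b i) φ / Ψ i 1) := by
      refine intervalIntegral.integral_congr fun ξ hξ => ?_
      rw [Set.uIcc_of_le (by norm_num)] at hξ
      rw [hr' ξ hξ]
      ring
    rw [e, intervalIntegral.integral_mul_const, (hΨ i).integral_sinc hc.ne', (hb i).2.2,
      (hΨ i).inner_opQ hc.ne']
    have := (hb i).2.1
    field_simp
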